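/- Let $L$ be a planar lattice with a two-way sublattice split: a simple graph whose vertex set ("sites") is $L=\mathbb Z^2\times I$ with $I$ finite and nonempty (the cell of a site and its position in the cell), whose edges (nearest neighbours) are invariant under the translations of $\mathbb Z^2$, with every site having finitely many neighbours, and with a partition of $I$ into equally many even and odd positions such that $L=L_e\sqcup L_o$ (even and odd sites) and every edge joins an even site to an odd site. Let $X^{hc}\subset\{0,1\}^L$ be the set of configurations with no two neighbouring $1$'s. Let $B_n\subset L$ be the set of sites in the cells of $[0,n)^2$, and $B_n^e=B_n\cap L_e$. For a probability measure $\mu$ on $\{0,1\}^L$ and a finite $A\subset L$ let $H_\mu(A)=-\sum_{a\in\{0,1\}^A}\mu(x|_A=a)\ln\mu(x|_A=a)$, with $0\ln 0=0$. **Proposition 2.1.** The limit $$h_{top}=\lim_{n\to\infty}\frac1{|B_n|}\ln\bigl|\{x|_{B_n}: x\in X^{hc}\}\bigr|$$ (the hard-core topological entropy) exists. There is a measure of maximal entropy, that is, a $\mathbb Z^2$-translation invariant probability measure $\mu$ on $\{0,1\}^L$ with $\mu(X^{hc})=1$ and $\lim_n H_\mu(B_n)/|B_n|=h_{top}$. For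 every such $\mu$, the entropy of its even marginal $h^{(e)}_{top}=\lim_n H_\mu(B_n^e)/|B_n^e|$ exists, and $$h_{top}=\tfrac12\Bigl\{h^{(e)}_{top}+\mathbf P(N_e)\ln 2\Bigr\}.$$ Here $\mathbf P(N_e)$ is the $\mu$-probability that all (even) neighbours of an odd site carry $0$, the odd site being drawn uniformly from the odd sites of one cell (if there is just one odd site per cell, as on the square and honeycomb lattices, this is the probability for any odd site). Moreover, $\mu$ is the law of the configuration obtained as follows: choose the even configuration according to the even marginal of $\mu$; then, independently of it, put independent $B(1/2)$ variables on the odd sites all of whose neighbours carry $0$, and put $0$ on all other odd sites. -/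

import Mathlib

open MeasureTheory Filter Topology

/-- The sites of a doubly periodic planar point set.  After a choice of a basis of its rank-two
group of translations and of a fundamental domain, each site is a pair: the cell (in `ℤ × ℤ`) that
contains it and its position `i : ι` inside the cell.  Translations act on the first component. -/
abbrev Site (ι : Type*) := (ℤ × ℤ) × ι

/-- Configurations in `{0,1}^L`; `true` is `1` (a particle) and `false` is `0`. -/
abbrev Config (ι : Type*) := Site ι → Bool

/-- A planar lattice (a doubly periodic, locally finite nearest neighbour graph) with a two-way
sublattice split: the positions in a cell are split into even and odd ones, equally many of
each, and nearest neighbours always lie on different sublattices. -/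
structure SplitLattice (ι : Type*) [Fintype ι] where
  graph : SimpleGraph (Site ι)
  adj_translate : ∀ (t u v : ℤ × ℤ) (i j : ι),
    graph.Adj (u, i) (v, j) → graph.Adj (t + u, i) (t + v, j)
  locallyFinite : ∀ v, (graph.neighborSet v).Finite
  isEven : ι → Bool
  bipartite : ∀ u v, graph.Adj u v → isEven u.2 ≠ isEven v.2
  equalDensity : (Finset.univ.filter fun i => isEven i = true).card =
    (Finset.univ.filter fun i => isEven i = false).card

/-- All sites in the cells of the `n × n` square `[0,n)²`. -/
noncomputable def siteBox (ι : Type*) [Fintype ι] (n : ℕ) : Finset (Site ι) :=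
  (Finset.Ico (0 : ℤ) n ×ˢ Finset.Ico (0 : ℤ) n) ×ˢ (Finset.univ : Finset ι)

/-- The number of different restrictions `x|_A` of the configurations `x ∈ X₀`. -/
noncomputable def patternCount {ι : Type*} (X₀ : Set (Config ι)) (A : Finset (Site ι)) : ℕ :=
  ((fun (x : Config ι) (v : A) => x v) '' X₀).ncard

open scoped Classical in
/-- The Shannon entropy (in nats) of the restriction of a `μ`-distributed configuration to `A`. -/
noncomputable def shannonEntropy {ι : Type*} (μ : Measure (Config ι)) (A : Finset (Site ι)) : ℝ :=
  ∑ a : A → Bool, Real.negMulLog (μ.real {x | ∀ v : A, x v = a v})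

/-- The configuration seen from the cell `t`. -/
def shift {ι : Type*} (t : ℤ × ℤ) (x : Config ι) : Config ι := fun v => x (t + v.1, v.2)

/-- The Bernoulli measure `B(1/2)` on all sites: independent fair coins. -/
noncomputable def fairCoins (ι : Type*) : Measure (Config ι) :=
  Measure.infinitePi fun _ : Site ι => (PMF.uniformOfFintype Bool).toMeasure

namespace SplitLattice

variable {ι : Type*} [Fintype ι] (L : SplitLattice ι)

/-- The configurations that obey the hard core rule. -/
def hardCore : Set (Config ι) :=
  {x | ∀ u v, L.graph.Adj u v → ¬ (x u = true ∧ x v = true)}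

/-- The even sites of the `n × n` square of cells. -/
noncomputable def evenBox (n : ℕ) : Finset (Site ι) :=
  (siteBox ι n).filter fun v => L.isEven v.2 = true

/-- Logarithm of the number of hard core patterns on the `n × n` square, per site. -/
noncomputable def topRate (n : ℕ) : ℝ :=
  Real.log (patternCount L.hardCore (siteBox ι n)) / (siteBox ι n).card

/-- The topological entropy of the hard core model, per site. -/
noncomputable def topEntropy : ℝ := limUnder atTop L.topRate

/-- A measure of maximal entropy: a translation invariant probability measure on the hard core
configurations whose entropy per site exists and is the topological entropy. -/
structure IsMaxEntropy (μ : Measure (Config ι)) : Prop where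
  prob : IsProbabilityMeasure μ
  invariant : ∀ t, μ.map (shift t) = μ
  hardCore_ae : ∀ᵐ x ∂μ, x ∈ L.hardCore
  entropy : Tendsto (fun n => shannonEntropy μ (siteBox ι n) / (siteBox ι n).card)
    atTop (𝓝 L.topEntropy)

/-- The entropy per even site of the restriction of `μ` to the even sites of the `n × n` square. -/
noncomputable def evenRate (μ : Measure (Config ι)) (n : ℕ) : ℝ :=
  shannonEntropy μ (L.evenBox n) / (L.evenBox n).card

/-- The entropy of the marginal of `μ` on the even sublattice, per even site. -/
noncomputable def evenEntropy (μ : Measure (Config ι)) : ℝ := limUnder atTop (L.evenRate μ)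

/-- The event that all nearest neighbours of the site `o` carry `0`.  If `o` is odd, all of these
neighbours are even. -/
def unblocked (o : Site ι) : Set (Config ι) := {x | ∀ v, L.graph.Adj o v → x v = false}

/-- The probability that the even neighbourhood of an odd site is all `0`: the odd site is drawn
uniformly from the odd sites of one cell.  If there is one odd site per cell, this is
the probability for that site and, by invariance, for every odd site. -/
noncomputable def probUnblocked (μ : Measure (Config ι)) : ℝ :=
  (∑ i with L.isEven i = false, μ.real (L.unblocked (0, i))) /
    (Finset.univ.filter fun i => L.isEven i = false).card

open scoped Classical in
/-- Keep `x` on the even sublattice; on the odd sublattice put `ω` on the sites that `x` does not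
block and `0` on the blocked ones. -/
noncomputable def fill (x ω : Config ι) : Config ι := fun v =>
  if L.isEven v.2 = true then x v else if x ∈ L.unblocked v then ω v else false

/-- The law of the configuration obtained from the even marginal of `μ` by filling the odd sites
that are not blocked with `B(1/2)`, independently of the even configuration. -/
noncomputable def fillIn (μ : Measure (Config ι)) : Measure (Config ι) :=
  (μ.prod (fairCoins ι)).map fun p => L.fill p.1 p.2

end SplitLattice

/-!
The entropy of a hard core law on a box splits into the entropy of its even part and the conditional
entropy of the odd part. Given the even configuration, an odd site can carry a `1` only if it is
unblocked, so it contributes at most `P(unblocked) * log 2` to the conditional entropy. Equality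
holds for independent fair coins on the unblocked sites, which is the refilled law `fillIn μ`, again
a hard core law with the same even marginal.

*Quantitative form.* On a window `C ∪ E`, where the even set `E` contains all neighbours of the odd
set `C`, Gibbs' inequality `shannonEntropy_le_cross` identifies the missing entropy, called
`deficit` below, with the relative entropy of `μ` with respect to `fillIn μ`. Hence it is
nonnegative, and it vanishes only if the two laws agree on the window. Strong subadditivity of
entropy makes the deficit superadditive over disjoint sets of odd sites
(`IsClosedWindow.deficit_add_le`).

*Rigidity.* Per cell, the deficit of a measure of maximal entropy on `[0,n)²` is, up to a boundary
term, at most a quantity whose limit is a positive multiple of `(h_even + P log 2) / 2 - h_top`.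
This limit is nonnegative because the deficit is, and nonpositive because the entropy of `fillIn μ`
is at most the logarithm of the number of hard core patterns. So it is zero, which is the entropy
formula. By superadditivity no window can have a positive deficit, as its translates would
contribute a positive density; therefore `μ = fillIn μ` (`IsMaxEntropy.rigidity`,
`IsMaxEntropy.eq_fillIn`).

*Existence.* The topological entropy and the even entropy are limits by Fekete's argument in two
dimensions (`exists_tendsto_density`); the topological entropy is also an infimum over boxes. A
measure of maximal entropy is a weak limit of translation averages of the uniform distributions on
patterns: by concavity of entropy and the covering of a large box by `m²` shifted grids of boxes of
side `m`, the averages have entropy at least `|B_m| h_top` on `B_m`, up to a boundary term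
(`mul_shannonEntropy_le_cellAverage`), and entropies of finite windows are continuous under weak
convergence (`exists_isMaxEntropy`).
-/

/-! ### Entropy of finite-valued observables -/

/-- Gibbs' inequality for finite families, with weights that need not be normalized. -/
theorem sum_negMulLog_le_cross {α : Type*} [Fintype α] {p q : α → ℝ} (hp : ∀ a, 0 ≤ p a)
    (hq : ∀ a, 0 ≤ q a) (hpq : ∀ a, q a = 0 → p a = 0) (hsum : ∑ a, q a ≤ ∑ a, p a) :
    ∑ a, Real.negMulLog (p a) ≤ ∑ a, p a * -Real.log (q a) := by
  have key : ∀ a, Real.negMulLog (p a) ≤ p a * -Real.log (q a) + (q a - p a) := fun a => by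
    rcases (hp a).eq_or_lt with h | h
    · simp [← h, hq a]
    have hqa : 0 < q a := lt_of_le_of_ne (hq a) fun h' => h.ne' (hpq a h'.symm)
    have := Real.log_le_sub_one_of_pos (div_pos hqa h)
    rw [Real.log_div hqa.ne' h.ne'] at this
    have h2 := mul_le_mul_of_nonneg_left this h.le
    rw [mul_sub, mul_sub, mul_div_cancel₀ _ h.ne'] at h2
    unfold Real.negMulLog
    linarith
  have := Finset.sum_le_sum fun a (_ : a ∈ Finset.univ) => key a
  rw [Finset.sum_add_distrib, Finset.sum_sub_distrib] at this
  linarith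

/-- The equality case of Gibbs' inequality. -/
theorem eq_of_sum_negMulLog_eq_cross {α : Type*} [Fintype α] {p q : α → ℝ} (hp : ∀ a, 0 ≤ p a)
    (hq : ∀ a, 0 ≤ q a) (hpq : ∀ a, q a = 0 → p a = 0) (hsum : ∑ a, q a ≤ ∑ a, p a)
    (heq : ∑ a, p a * -Real.log (q a) ≤ ∑ a, Real.negMulLog (p a)) : p = q := by
  have key : ∀ a, Real.negMulLog (p a) ≤ p a * -Real.log (q a) + (q a - p a) ∧
      (Real.negMulLog (p a) = p a * -Real.log (q a) + (q a - p a) → p a = q a) := fun a => by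
    rcases (hp a).eq_or_lt with h | h
    · simp [← h, hq a]
    have hqa : 0 < q a := lt_of_le_of_ne (hq a) fun h' => h.ne' (hpq a h'.symm)
    by_cases h1 : q a / p a = 1
    · rw [div_eq_one_iff_eq h.ne'] at h1
      simp [h1, Real.negMulLog]
    have := Real.log_lt_sub_one_of_pos (div_pos hqa h) h1
    rw [Real.log_div hqa.ne' h.ne'] at this
    have h2 := mul_lt_mul_of_pos_left this h
    rw [mul_sub, mul_sub, mul_div_cancel₀ _ h.ne'] at h2
    unfold Real.negMulLog
    exact ⟨by linarith, fun h3 => absurd h3 (by linarith)⟩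
  have hle := Finset.sum_le_sum fun a (_ : a ∈ Finset.univ) => (key a).1
  have heq' : ∑ a, Real.negMulLog (p a) = ∑ a, (p a * -Real.log (q a) + (q a - p a)) := by
    refine le_antisymm hle ?_
    rw [Finset.sum_add_distrib, Finset.sum_sub_distrib]
    linarith
  rw [Finset.sum_eq_sum_iff_of_le fun a _ => (key a).1] at heq'
  exact funext fun a => (key a).2 (heq' a (Finset.mem_univ a))

/-- Strong subadditivity of entropy for a finite array: `q = p_{ac} p_{bc} / p_c` competes with `p`
in Gibbs' inequality. -/
theorem sum_negMulLog_submodular {α β γ : Type*} [Fintype α] [Fintype β] [Fintype γ]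
    {p : α → β → γ → ℝ} (hp : ∀ a b c, 0 ≤ p a b c) :
    ∑ x : α × β × γ, Real.negMulLog (p x.1 x.2.1 x.2.2) +
        ∑ c, Real.negMulLog (∑ a, ∑ b, p a b c) ≤
      ∑ x : α × γ, Real.negMulLog (∑ b, p x.1 b x.2) +
        ∑ x : β × γ, Real.negMulLog (∑ a, p a x.1 x.2) := by
  set s := fun c => ∑ a, ∑ b, p a b c with hs
  set u := fun a c => ∑ b, p a b c with hu
  set v := fun b c => ∑ a, p a b c with hv
  have hu0 : ∀ a c, 0 ≤ u a c := fun a c => Finset.sum_nonneg fun b _ => hp a b c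
  have hv0 : ∀ b c, 0 ≤ v b c := fun b c => Finset.sum_nonneg fun a _ => hp a b c
  have hs0 : ∀ c, 0 ≤ s c := fun c => Finset.sum_nonneg fun a _ => hu0 a c
  have hpu : ∀ a b c, p a b c ≤ u a c := fun a b c =>
    Finset.single_le_sum (f := fun b => p a b c) (fun b _ => hp a b c) (Finset.mem_univ b)
  have hpv : ∀ a b c, p a b c ≤ v b c := fun a b c =>
    Finset.single_le_sum (f := fun a => p a b c) (fun a _ => hp a b c) (Finset.mem_univ a)
  have hus : ∀ a c, u a c ≤ s c := fun a c =>
    Finset.single_le_sum (f := fun a => u a c) (fun a _ => hu0 a c) (Finset.mem_univ a)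
  have hsu : ∀ c, ∑ a, u a c = s c := fun c => rfl
  have hsv : ∀ c, ∑ b, v b c = s c := fun c => Finset.sum_comm
  have key : ∀ a b c, Real.negMulLog (p a b c) - p a b c * Real.log (s c)
      ≤ p a b c * -Real.log (u a c) + p a b c * -Real.log (v b c)
        + (u a c * v b c / s c - p a b c) := fun a b c => by
    rcases (hp a b c).eq_or_lt with h | h
    · simpa [← h] using div_nonneg (mul_nonneg (hu0 a c) (hv0 b c)) (hs0 c)
    have h1 : 0 < u a c := h.trans_le (hpu a b c)
    have h2 : 0 < v b c := h.trans_le (hpv a b c)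
    have h3 : 0 < s c := h1.trans_le (hus a c)
    have h4 : 0 < u a c * v b c / s c := by positivity
    have := Real.log_le_sub_one_of_pos (div_pos h4 h)
    rw [Real.log_div h4.ne' h.ne', Real.log_div (mul_pos h1 h2).ne' h3.ne',
      Real.log_mul h1.ne' h2.ne'] at this
    have h5 := mul_le_mul_of_nonneg_left this h.le
    rw [mul_sub (p a b c) (_ / _), mul_div_cancel₀ _ h.ne'] at h5
    unfold Real.negMulLog
    linarith
  have tot := Finset.sum_le_sum fun c (_ : c ∈ Finset.univ) =>
    Finset.sum_le_sum fun a (_ : a ∈ Finset.univ) =>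
    Finset.sum_le_sum fun b (_ : b ∈ Finset.univ) => key a b c
  simp only [Finset.sum_add_distrib, Finset.sum_sub_distrib] at tot
  have e1 : ∑ x : α × β × γ, Real.negMulLog (p x.1 x.2.1 x.2.2)
      = ∑ c, ∑ a, ∑ b, Real.negMulLog (p a b c) := by
    simp only [Fintype.sum_prod_type]
    rw [Finset.sum_comm (s := (Finset.univ : Finset γ))]
    exact Finset.sum_congr rfl fun a _ => Finset.sum_comm
  have e2 : ∑ c, ∑ a, ∑ b, p a b c * Real.log (s c) = - ∑ c, Real.negMulLog (s c) := by
    rw [← Finset.sum_neg_distrib]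
    refine Finset.sum_congr rfl fun c _ => ?_
    simp only [← Finset.sum_mul, Real.negMulLog, hs]
    ring
  have e3 : ∑ x : α × γ, Real.negMulLog (u x.1 x.2)
      = ∑ c, ∑ a, ∑ b, p a b c * -Real.log (u a c) := by
    rw [Fintype.sum_prod_type, Finset.sum_comm]
    refine Finset.sum_congr rfl fun c _ => Finset.sum_congr rfl fun a _ => ?_
    simp only [← Finset.sum_mul, Real.negMulLog, hu]
    ring
  have e4 : ∑ x : β × γ, Real.negMulLog (v x.1 x.2)
      = ∑ c, ∑ a, ∑ b, p a b c * -Real.log (v b c) := by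
    rw [Fintype.sum_prod_type, Finset.sum_comm]
    refine Finset.sum_congr rfl fun c _ => ?_
    rw [Finset.sum_comm]
    refine Finset.sum_congr rfl fun b _ => ?_
    simp only [← Finset.sum_mul, Real.negMulLog, hv]
    ring
  have e5 : ∑ c, ∑ a, ∑ b, u a c * v b c / s c ≤ ∑ c, ∑ a, ∑ b, p a b c := by
    refine Finset.sum_le_sum fun c _ => ?_
    simp only [← Finset.sum_div, ← Finset.mul_sum, ← Finset.sum_mul, hsu, hsv]
    exact (mul_self_div_self (s c)).le
  rw [e1, e3, e4]
  linarith

section Observable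

variable {Ω α β γ : Type*} [MeasurableSpace Ω]

/-- The Shannon entropy (in nats) of a finite-valued observable `f`, as the expected information.
This form depends on `f` only through the partition into its level sets. -/
noncomputable def obsEntropy (μ : Measure Ω) (f : Ω → α) : ℝ :=
  ∫ x, -Real.log (μ.real (f ⁻¹' {f x})) ∂μ

theorem obsEntropy_congr (μ : Measure Ω) {f : Ω → α} {g : Ω → β}
    (h : ∀ x y, f x = f y ↔ g x = g y) : obsEntropy μ f = obsEntropy μ g := by
  unfold obsEntropy
  congr! with x
  ext y
  exact h y x

/-- Almost every point has an atom of positive mass. -/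
theorem ae_pos_measureReal_atom [Finite α] (μ : Measure Ω) [IsFiniteMeasure μ] (f : Ω → α) :
    ∀ᵐ x ∂μ, 0 < μ.real (f ⁻¹' {f x}) := by
  have h : ∀ᵐ x ∂μ, ∀ a, f x = a → 0 < μ.real (f ⁻¹' {a}) := by
    refine ae_all_iff.2 fun a => ?_
    rcases eq_or_ne (μ (f ⁻¹' {a})) 0 with h0 | h0
    · filter_upwards [measure_eq_zero_iff_ae_notMem.1 h0] with x hx hxa using absurd hxa hx
    · exact Eventually.of_forall fun x _ => ENNReal.toReal_pos h0 (measure_ne_top _ _)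
  filter_upwards [h] with x hx using hx _ rfl

variable [Finite α] [MeasurableSpace α] [MeasurableSingletonClass α]

theorem integrable_comp_of_finite (μ : Measure Ω) [IsFiniteMeasure μ] {f : Ω → α}
    (hf : Measurable f) (φ : α → ℝ) : Integrable (fun x => φ (f x)) μ :=
  (Integrable.of_finite (μ := μ.map f) (f := φ)).comp_measurable hf

theorem integral_comp_of_fintype {α : Type*} [Fintype α] [MeasurableSpace α]
    [MeasurableSingletonClass α] (μ : Measure Ω) [IsFiniteMeasure μ] {f : Ω → α}
    (hf : Measurable f) (φ : α → ℝ) :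
    ∫ x, φ (f x) ∂μ = ∑ a, μ.real (f ⁻¹' {a}) * φ a := by
  rw [← integral_map (f := φ) hf.aemeasurable (measurable_of_finite φ).aestronglyMeasurable,
    integral_fintype .of_finite]
  simp [map_measureReal_apply hf (measurableSet_singleton _)]

theorem obsEntropy_eq_sum {α : Type*} [Fintype α] [MeasurableSpace α]
    [MeasurableSingletonClass α] (μ : Measure Ω) [IsFiniteMeasure μ] {f : Ω → α}
    (hf : Measurable f) : obsEntropy μ f = ∑ a, Real.negMulLog (μ.real (f ⁻¹' {a})) := by
  rw [obsEntropy, integral_comp_of_fintype μ hf fun a => -Real.log (μ.real (f ⁻¹' {a}))]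
  simp [Real.negMulLog]

theorem sum_measureReal_inter_preimage_singleton {α : Type*} [Fintype α] [MeasurableSpace α]
    [MeasurableSingletonClass α] (μ : Measure Ω) [IsFiniteMeasure μ] {f : Ω → α}
    (hf : Measurable f) {s : Set Ω} (hs : MeasurableSet s) :
    ∑ a, μ.real (f ⁻¹' {a} ∩ s) = μ.real s := by
  rw [← measureReal_biUnion_finset]
  · congr 1; ext x; simp
  · intro a _ b _ hab
    exact Set.disjoint_left.2 fun x hx hx' => hab (hx.1.symm.trans hx'.1)
  · exact fun a _ => (hf (measurableSet_singleton a)).inter hs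

variable [Finite β] [MeasurableSpace β] [MeasurableSingletonClass β] [Finite γ] [MeasurableSpace γ]
  [MeasurableSingletonClass γ]

/-- Strong subadditivity: the conditional mutual information of `f` and `g` given `h` is
nonnegative. -/
theorem obsEntropy_submodular (μ : Measure Ω) [IsFiniteMeasure μ] {f : Ω → α} {g : Ω → β}
    {h : Ω → γ} (hf : Measurable f) (hg : Measurable g) (hh : Measurable h) :
    obsEntropy μ (fun x => (f x, g x, h x)) + obsEntropy μ h ≤
      obsEntropy μ (fun x => (f x, h x)) + obsEntropy μ (fun x => (g x, h x)) := by
  have := Fintype.ofFinite α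
  have := Fintype.ofFinite β
  have := Fintype.ofFinite γ
  rw [obsEntropy_eq_sum μ (hf.prodMk (hg.prodMk hh)), obsEntropy_eq_sum μ hh,
    obsEntropy_eq_sum μ (hf.prodMk hh), obsEntropy_eq_sum μ (hg.prodMk hh)]
  have hF : ∀ a, MeasurableSet (f ⁻¹' {a}) := fun a => hf (measurableSet_singleton a)
  have hG : ∀ a, MeasurableSet (g ⁻¹' {a}) := fun a => hg (measurableSet_singleton a)
  have hH : ∀ a, MeasurableSet (h ⁻¹' {a}) := fun a => hh (measurableSet_singleton a)
  have main := sum_negMulLog_submodular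
    (p := fun a b c => μ.real (f ⁻¹' {a} ∩ (g ⁻¹' {b} ∩ h ⁻¹' {c}))) fun _ _ _ => measureReal_nonneg
  have e1 : ∀ a c, ∑ b, μ.real (f ⁻¹' {a} ∩ (g ⁻¹' {b} ∩ h ⁻¹' {c}))
      = μ.real (f ⁻¹' {a} ∩ h ⁻¹' {c}) := fun a c => by
    rw [← sum_measureReal_inter_preimage_singleton μ hg ((hF a).inter (hH c))]
    simp only [Set.inter_left_comm]
  have e2 : ∀ b c, ∑ a, μ.real (f ⁻¹' {a} ∩ (g ⁻¹' {b} ∩ h ⁻¹' {c}))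
      = μ.real (g ⁻¹' {b} ∩ h ⁻¹' {c}) := fun b c =>
    sum_measureReal_inter_preimage_singleton μ hf ((hG b).inter (hH c))
  simp only [e1, e2, sum_measureReal_inter_preimage_singleton μ hf (hH _)] at main
  have r3 : ∀ x : α × β × γ, (fun x => (f x, g x, h x)) ⁻¹' {x}
      = f ⁻¹' {x.1} ∩ (g ⁻¹' {x.2.1} ∩ h ⁻¹' {x.2.2}) := fun x => by
    ext y; simp [Prod.ext_iff]
  have r1 : ∀ x : α × γ, (fun x => (f x, h x)) ⁻¹' {x} = f ⁻¹' {x.1} ∩ h ⁻¹' {x.2} := fun x => by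
    ext y; simp [Prod.ext_iff]
  have r2 : ∀ x : β × γ, (fun x => (g x, h x)) ⁻¹' {x} = g ⁻¹' {x.1} ∩ h ⁻¹' {x.2} := fun x => by
    ext y; simp [Prod.ext_iff]
  simpa only [r1, r2, r3] using main

/-- Gibbs' inequality: the entropy of `f` under `μ` is at most its cross entropy relative to `ν`,
and equality forces `f` to have the same law under both measures. -/
theorem obsEntropy_le_cross (μ ν : Measure Ω) [IsProbabilityMeasure μ] [IsProbabilityMeasure ν]
    {f : Ω → α} (hf : Measurable f) (hpos : ∀ᵐ x ∂μ, ν.real (f ⁻¹' {f x}) ≠ 0) :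
    obsEntropy μ f ≤ ∫ x, -Real.log (ν.real (f ⁻¹' {f x})) ∂μ ∧
    (∫ x, -Real.log (ν.real (f ⁻¹' {f x})) ∂μ ≤ obsEntropy μ f →
      ∀ a, μ.real (f ⁻¹' {a}) = ν.real (f ⁻¹' {a})) := by
  have := Fintype.ofFinite α
  rw [obsEntropy_eq_sum μ hf,
    integral_comp_of_fintype μ hf fun a => -Real.log (ν.real (f ⁻¹' {a}))]
  have h0 : ∀ a, ν.real (f ⁻¹' {a}) = 0 → μ.real (f ⁻¹' {a}) = 0 := fun a ha => by
    rw [measureReal_eq_zero_iff]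
    refine measure_mono_null (fun x hx => ?_) hpos
    have hx : f x = a := hx
    simpa [hx] using ha
  have hs : ∀ (ρ : Measure Ω) [IsProbabilityMeasure ρ], ∑ a, ρ.real (f ⁻¹' {a}) = 1 := fun ρ _ => by
    simpa using sum_measureReal_inter_preimage_singleton ρ hf MeasurableSet.univ
  have hle : ∑ a, ν.real (f ⁻¹' {a}) ≤ ∑ a, μ.real (f ⁻¹' {a}) := by rw [hs, hs]
  exact ⟨sum_negMulLog_le_cross (fun _ => measureReal_nonneg) (fun _ => measureReal_nonneg) h0 hle,
    fun heq => congrFun (eq_of_sum_negMulLog_eq_cross (fun _ => measureReal_nonneg)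
      (fun _ => measureReal_nonneg) h0 hle heq)⟩

theorem obsEntropy_le_log_card (μ : Measure Ω) [IsProbabilityMeasure μ]
    {f : Ω → α} (hf : Measurable f) (S : Finset α) (hS : ∀ᵐ x ∂μ, f x ∈ S) :
    obsEntropy μ f ≤ Real.log S.card := by
  classical
  have := Fintype.ofFinite α
  have hs : ∑ a, μ.real (f ⁻¹' {a}) = 1 := by
    simpa using sum_measureReal_inter_preimage_singleton μ hf MeasurableSet.univ
  have hne : (S.card : ℝ) ≠ 0 := by
    obtain ⟨x, hx⟩ := hS.exists
    exact_mod_cast (Finset.card_pos.2 ⟨_, hx⟩).ne'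
  have h0 : ∀ a, a ∉ S → μ.real (f ⁻¹' {a}) = 0 := fun a ha => by
    rw [measureReal_eq_zero_iff]
    refine measure_mono_null (fun x hx => ?_) hS
    have hx : f x = a := hx
    simpa [hx] using ha
  rw [obsEntropy_eq_sum μ hf]
  refine (sum_negMulLog_le_cross (q := fun a => if a ∈ S then (S.card : ℝ)⁻¹ else 0)
    (fun _ => measureReal_nonneg) (fun a => by positivity) (fun a ha => ?_) ?_).trans ?_
  · by_contra h
    have : a ∈ S := not_imp_comm.1 (h0 a) h
    simp [this, hne] at ha
  · rw [hs]; simp [Finset.sum_ite_mem, hne]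
  · refine le_of_eq ?_
    calc _ = ∑ a, μ.real (f ⁻¹' {a}) * Real.log S.card := by
            refine Finset.sum_congr rfl fun a _ => ?_
            by_cases h : a ∈ S <;> simp [h, h0, Real.log_inv]
      _ = _ := by rw [← Finset.sum_mul, hs, one_mul]

end Observable

/-! ### Entropy and pattern counts of finite windows -/

/-- The cylinder of the configurations that agree with `x` on `A`. -/
def cyl {ι : Type*} (A : Finset (Site ι)) (x : Config ι) : Set (Config ι) :=
  {y | ∀ v ∈ A, y v = x v}

/-- The finite set of sites `A`, translated by the vector `t` of cells. -/
def translateSites {ι : Type*} (t : ℤ × ℤ) (A : Finset (Site ι)) : Finset (Site ι) :=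
  A.map ((Equiv.addLeft t).prodCongr (Equiv.refl ι)).toEmbedding

section Windows

variable {ι : Type*}

theorem mem_translateSites {t : ℤ × ℤ} {A : Finset (Site ι)} {v : Site ι} :
    v ∈ translateSites t A ↔ (v.1 - t, v.2) ∈ A := by
  simp only [translateSites, Finset.mem_map]
  constructor
  · rintro ⟨u, hu, rfl⟩; simpa using hu
  · exact fun h => ⟨_, h, by simp⟩

theorem translateSites_neg_translateSites (t : ℤ × ℤ) (A : Finset (Site ι)) :
    translateSites (-t) (translateSites t A) = A := by
  ext v; simp [mem_translateSites]

theorem restrict_preimage_singleton (A : Finset (Site ι)) (x : Config ι) :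
    (A.restrict : Config ι → A → Bool) ⁻¹' {A.restrict x} = cyl A x := by
  ext y; simp [cyl, funext_iff]

theorem restrict_eq_restrict_iff {A : Finset (Site ι)} {x y : Config ι} :
    A.restrict x = A.restrict y ↔ ∀ v ∈ A, x v = y v := by
  simp [funext_iff]

theorem measurable_restrict (A : Finset (Site ι)) :
    Measurable (A.restrict : Config ι → A → Bool) := Finset.measurable_restrict A

theorem measurableSet_cyl (A : Finset (Site ι)) (x : Config ι) : MeasurableSet (cyl A x) := by
  rw [← restrict_preimage_singleton]
  exact measurable_restrict A (measurableSet_singleton _)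

theorem exists_restrict_eq {A : Finset (Site ι)} (a : A → Bool) :
    ∃ x : Config ι, A.restrict x = a := by
  classical
  exact ⟨fun v => if h : v ∈ A then a ⟨v, h⟩ else false, by ext v; simp⟩

/-- A finite measure on configurations is determined by the masses of arbitrarily large
cylinders. -/
theorem measure_ext_of_cyl {μ ν : Measure (Config ι)} [IsFiniteMeasure μ] [IsFiniteMeasure ν]
    (h : ∀ A : Finset (Site ι), ∃ B, A ⊆ B ∧ ∀ x, μ.real (cyl B x) = ν.real (cyl B x)) :
    μ = ν := by
  have hB : ∀ B : Finset (Site ι), (∀ x, μ.real (cyl B x) = ν.real (cyl B x)) →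
      μ.map B.restrict = ν.map B.restrict := fun B hB => by
    refine Measure.ext_of_singleton fun a => ?_
    obtain ⟨x, rfl⟩ := exists_restrict_eq a
    rw [Measure.map_apply (measurable_restrict B) (measurableSet_singleton _),
      Measure.map_apply (measurable_restrict B) (measurableSet_singleton _),
      restrict_preimage_singleton]
    exact (measureReal_eq_measureReal_iff).1 (hB x)
  refine IsProjectiveLimit.unique (P := fun A : Finset (Site ι) => μ.map A.restrict)
    (fun A => rfl) fun A => ?_
  obtain ⟨B, hAB, hx⟩ := h A
  have e : (A.restrict : Config ι → A → Bool) =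
      Finset.restrict₂ (π := fun _ => Bool) hAB ∘ B.restrict := rfl
  have m : Measurable (Finset.restrict₂ (π := fun _ : Site ι => Bool) hAB) :=
    Finset.measurable_restrict₂ hAB
  change ν.map (A.restrict : Config ι → A → Bool) = μ.map (A.restrict : Config ι → A → Bool)
  rw [e, ← Measure.map_map m (measurable_restrict B), ← Measure.map_map m (measurable_restrict B),
    hB B hx]

theorem shannonEntropy_eq_obsEntropy (μ : Measure (Config ι)) [IsFiniteMeasure μ]
    (A : Finset (Site ι)) :
    shannonEntropy μ A = obsEntropy μ (A.restrict : Config ι → A → Bool) := by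
  classical
  rw [obsEntropy_eq_sum μ (measurable_restrict A), shannonEntropy]
  refine Finset.sum_congr (by congr!) fun a _ => ?_
  congr 2
  ext x
  simp [funext_iff]

/-- The entropy of a window is the expected information of the cylinder around a random
configuration. -/
theorem shannonEntropy_eq_integral (μ : Measure (Config ι)) [IsFiniteMeasure μ]
    (A : Finset (Site ι)) : shannonEntropy μ A = ∫ x, -Real.log (μ.real (cyl A x)) ∂μ := by
  simp_rw [shannonEntropy_eq_obsEntropy, obsEntropy, restrict_preimage_singleton]

theorem ae_pos_cyl (μ : Measure (Config ι)) [IsFiniteMeasure μ] (A : Finset (Site ι)) :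
    ∀ᵐ x ∂μ, 0 < μ.real (cyl A x) := by
  simpa only [restrict_preimage_singleton] using
    ae_pos_measureReal_atom μ (A.restrict : Config ι → A → Bool)

theorem integrable_of_dependsOn (μ : Measure (Config ι)) [IsFiniteMeasure μ] (A : Finset (Site ι))
    {φ : Config ι → ℝ} (h : ∀ x y, (∀ v ∈ A, x v = y v) → φ x = φ y) : Integrable φ μ := by
  classical
  have := integrable_comp_of_finite μ (measurable_restrict A)
    (fun a : A → Bool => φ fun v => if h : v ∈ A then a ⟨v, h⟩ else false)
  convert this using 2 with x
  exact h _ _ fun v hv => by simp [hv]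

theorem cyl_congr {A : Finset (Site ι)} {x y : Config ι} (h : ∀ v ∈ A, x v = y v) :
    cyl A x = cyl A y := by
  ext z
  exact forall₂_congr fun v hv => by rw [h v hv]

theorem integrable_log_cyl (μ ν : Measure (Config ι)) [IsFiniteMeasure μ] (A : Finset (Site ι)) :
    Integrable (fun x => -Real.log (ν.real (cyl A x))) μ :=
  integrable_of_dependsOn μ A fun x y h => by rw [cyl_congr h]

theorem shannonEntropy_empty (μ : Measure (Config ι)) [IsProbabilityMeasure μ] :
    shannonEntropy μ ∅ = 0 := by
  simp [shannonEntropy_eq_integral, cyl]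

theorem shannonEntropy_mono (μ : Measure (Config ι)) [IsProbabilityMeasure μ]
    {A B : Finset (Site ι)} (h : A ⊆ B) : shannonEntropy μ A ≤ shannonEntropy μ B := by
  rw [shannonEntropy_eq_integral, shannonEntropy_eq_integral]
  refine integral_mono_ae (integrable_log_cyl _ _ _) (integrable_log_cyl _ _ _) ?_
  filter_upwards [ae_pos_cyl μ B] with x hx
  exact neg_le_neg (Real.log_le_log hx
    (measureReal_mono (fun y hy v hv => hy v (h hv)) (measure_ne_top _ _)))

theorem shannonEntropy_nonneg (μ : Measure (Config ι)) [IsProbabilityMeasure μ]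
    (A : Finset (Site ι)) : 0 ≤ shannonEntropy μ A :=
  (shannonEntropy_empty μ).symm.le.trans (shannonEntropy_mono μ (Finset.empty_subset A))

open scoped Classical in
theorem shannonEntropy_submodular (μ : Measure (Config ι)) [IsProbabilityMeasure μ]
    (A B : Finset (Site ι)) : shannonEntropy μ (A ∪ B) + shannonEntropy μ (A ∩ B) ≤
      shannonEntropy μ A + shannonEntropy μ B := by
  have := obsEntropy_submodular μ (measurable_restrict (A \ B)) (measurable_restrict (B \ A))
    (measurable_restrict (A ∩ B))
  simp only [shannonEntropy_eq_obsEntropy]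
  convert this using 2
  all_goals
    refine obsEntropy_congr μ fun x y => ?_
    simp only [Prod.mk.injEq, restrict_eq_restrict_iff, Finset.mem_union, Finset.mem_sdiff,
      Finset.mem_inter]
    grind

open scoped Classical in
theorem shannonEntropy_union_le (μ : Measure (Config ι)) [IsProbabilityMeasure μ]
    (A B : Finset (Site ι)) :
    shannonEntropy μ (A ∪ B) ≤ shannonEntropy μ A + shannonEntropy μ B := by
  linarith [shannonEntropy_submodular μ A B, shannonEntropy_nonneg μ (A ∩ B)]

theorem measurable_shift (t : ℤ × ℤ) : Measurable (shift t : Config ι → Config ι) :=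
  measurable_pi_iff.2 fun _ => measurable_pi_apply _

theorem shift_preimage_cyl (t : ℤ × ℤ) (A : Finset (Site ι)) (x : Config ι) :
    shift t ⁻¹' cyl A (shift t x) = cyl (translateSites t A) x := by
  ext y
  refine (Iff.trans ?_ (Finset.forall_mem_map (s := A)).symm)
  rfl

theorem shannonEntropy_map_shift (μ : Measure (Config ι)) [IsProbabilityMeasure μ] (t : ℤ × ℤ)
    (A : Finset (Site ι)) :
    shannonEntropy (μ.map (shift t)) A = shannonEntropy μ (translateSites t A) := by
  have := Measure.isProbabilityMeasure_map (μ := μ) (measurable_shift t).aemeasurable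
  rw [shannonEntropy_eq_integral, shannonEntropy_eq_integral, integral_map
    (measurable_shift t).aemeasurable (integrable_log_cyl _ _ _).aestronglyMeasurable]
  simp_rw [map_measureReal_apply (measurable_shift t) (measurableSet_cyl _ _), shift_preimage_cyl]

theorem patternCount_pos {X₀ : Set (Config ι)} (h : X₀.Nonempty) (A : Finset (Site ι)) :
    0 < patternCount X₀ A :=
  (Set.ncard_pos (Set.toFinite _)).2 (h.image _)

theorem patternCount_mono (X₀ : Set (Config ι)) {A B : Finset (Site ι)} (h : A ⊆ B) :
    patternCount X₀ A ≤ patternCount X₀ B := by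
  have : (fun (x : Config ι) (v : A) => x v) '' X₀ =
      Finset.restrict₂ (π := fun _ => Bool) h '' ((fun (x : Config ι) (v : B) => x v) '' X₀) := by
    rw [Set.image_image]; rfl
  rw [patternCount, this]
  exact Set.ncard_image_le (Set.toFinite _)

open scoped Classical in
theorem patternCount_union_le (X₀ : Set (Config ι)) (A B : Finset (Site ι)) :
    patternCount X₀ (A ∪ B) ≤ patternCount X₀ A * patternCount X₀ B := by
  unfold patternCount
  rw [← Set.ncard_prod]
  refine Set.ncard_le_ncard_of_injOn
    (fun a => (Finset.restrict₂ (π := fun _ => Bool) (Finset.subset_union_left (s₂ := B)) a,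
      Finset.restrict₂ (π := fun _ => Bool) (Finset.subset_union_right (s₁ := A)) a))
    ?_ ?_ (Set.toFinite _)
  · rintro _ ⟨x, hx, rfl⟩
    exact ⟨⟨x, hx, rfl⟩, ⟨x, hx, rfl⟩⟩
  · intro a _ b _ hab
    simp only [Prod.mk.injEq, funext_iff, Finset.restrict₂, Subtype.forall] at hab
    ext ⟨v, hv⟩
    rcases Finset.mem_union.1 hv with h | h
    · rw [hab.1 v h]
    · rw [hab.2 v h]

theorem log_patternCount_le (X₀ : Set (Config ι)) (h : X₀.Nonempty) (A : Finset (Site ι)) :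
    Real.log (patternCount X₀ A) ≤ A.card * Real.log 2 := by
  classical
  rw [← Real.log_pow]
  refine Real.log_le_log (by exact_mod_cast patternCount_pos h A) ?_
  have := Set.ncard_le_card ((fun (x : Config ι) (v : A) => x v) '' X₀)
  rw [Nat.card_eq_fintype_card] at this
  simp only [Fintype.card_pi, Fintype.card_bool, Finset.prod_const, Finset.card_univ,
    Fintype.card_coe] at this
  exact_mod_cast this

theorem log_patternCount_nonneg (X₀ : Set (Config ι)) (A : Finset (Site ι)) :
    0 ≤ Real.log (patternCount X₀ A) := Real.log_natCast_nonneg _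

theorem log_patternCount_mono (X₀ : Set (Config ι)) (hX : X₀.Nonempty) {A B : Finset (Site ι)}
    (h : A ⊆ B) : Real.log (patternCount X₀ A) ≤ Real.log (patternCount X₀ B) :=
  Real.log_le_log (by exact_mod_cast patternCount_pos hX A)
    (by exact_mod_cast patternCount_mono X₀ h)

open scoped Classical in
theorem log_patternCount_union_le (X₀ : Set (Config ι)) (hX : X₀.Nonempty)
    (A B : Finset (Site ι)) : Real.log (patternCount X₀ (A ∪ B)) ≤
      Real.log (patternCount X₀ A) + Real.log (patternCount X₀ B) := by
  rw [← Real.log_mul (by exact_mod_cast (patternCount_pos hX A).ne')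
    (by exact_mod_cast (patternCount_pos hX B).ne')]
  exact Real.log_le_log (by exact_mod_cast patternCount_pos hX _)
    (by exact_mod_cast patternCount_union_le X₀ A B)

theorem patternCount_translateSites_le {X₀ : Set (Config ι)} {t : ℤ × ℤ}
    (h : ∀ x ∈ X₀, shift t x ∈ X₀) (A : Finset (Site ι)) :
    patternCount X₀ (translateSites t A) ≤ patternCount X₀ A := by
  refine Set.ncard_le_ncard_of_injOn
    (fun a v => a ⟨(t + v.1.1, v.1.2), by simp [mem_translateSites]⟩) ?_ ?_ (Set.toFinite _)
  · rintro _ ⟨x, hx, rfl⟩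
    exact ⟨shift t x, h x hx, rfl⟩
  · intro a _ b _ hab
    ext ⟨v, hv⟩
    have := congrFun hab ⟨_, mem_translateSites.1 hv⟩
    simpa using congrArg (fun b : Bool => b = true) this

theorem patternCount_translateSites {X₀ : Set (Config ι)} (h : ∀ t, ∀ x ∈ X₀, shift t x ∈ X₀)
    (t : ℤ × ℤ) (A : Finset (Site ι)) :
    patternCount X₀ (translateSites t A) = patternCount X₀ A := by
  refine (patternCount_translateSites_le (h t) A).antisymm ?_
  conv_lhs => rw [← translateSites_neg_translateSites t A]
  exact patternCount_translateSites_le (h (-t)) _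

theorem shannonEntropy_le_log_patternCount (μ : Measure (Config ι)) [IsProbabilityMeasure μ]
    {X₀ : Set (Config ι)} (h : ∀ᵐ x ∂μ, x ∈ X₀) (A : Finset (Site ι)) :
    shannonEntropy μ A ≤ Real.log (patternCount X₀ A) := by
  classical
  rw [shannonEntropy_eq_obsEntropy, patternCount,
    Set.ncard_eq_toFinset_card _ (Set.toFinite _)]
  refine obsEntropy_le_log_card μ (measurable_restrict A) _ ?_
  filter_upwards [h] with x hx
  exact (Set.Finite.mem_toFinset _).2 ⟨x, hx, rfl⟩

theorem shannonEntropy_le_card (μ : Measure (Config ι)) [IsProbabilityMeasure μ]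
    (A : Finset (Site ι)) : shannonEntropy μ A ≤ A.card * Real.log 2 :=
  (shannonEntropy_le_log_patternCount μ (X₀ := Set.univ) (by simp) A).trans
    (log_patternCount_le _ Set.univ_nonempty A)

/-- Gibbs' inequality, with its equality case, for the restrictions of two measures to a window. -/
theorem shannonEntropy_le_cross (μ ν : Measure (Config ι)) [IsProbabilityMeasure μ]
    [IsProbabilityMeasure ν] (A : Finset (Site ι)) (hpos : ∀ᵐ x ∂μ, ν.real (cyl A x) ≠ 0) :
    shannonEntropy μ A ≤ ∫ x, -Real.log (ν.real (cyl A x)) ∂μ ∧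
    (∫ x, -Real.log (ν.real (cyl A x)) ∂μ ≤ shannonEntropy μ A →
      ∀ x, μ.real (cyl A x) = ν.real (cyl A x)) := by
  have := obsEntropy_le_cross μ ν (measurable_restrict A)
  simp only [restrict_preimage_singleton, ← shannonEntropy_eq_obsEntropy] at this
  refine ⟨(this hpos).1, fun h x => ?_⟩
  simpa only [restrict_preimage_singleton] using (this hpos).2 h (A.restrict x)

end Windows

/-! ### Subadditivity over square boxes -/

section Boxes

open scoped Pointwise

/-- The square `[0,n)²` of cells. -/
noncomputable def cellBox (n : ℕ) : Finset (ℤ × ℤ) := Finset.Ico (0 : ℤ) n ×ˢ Finset.Ico (0 : ℤ) n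

theorem mem_vadd_cellBox {t x : ℤ × ℤ} {n : ℕ} : x ∈ t +ᵥ cellBox n ↔
    (t.1 ≤ x.1 ∧ x.1 < t.1 + n) ∧ (t.2 ≤ x.2 ∧ x.2 < t.2 + n) := by
  rw [← Finset.neg_vadd_mem_iff]
  simp only [cellBox, Finset.mem_product, Finset.mem_Ico, vadd_eq_add, Prod.fst_add, Prod.fst_neg,
    Prod.snd_add, Prod.snd_neg]
  omega

theorem card_cellBox (n : ℕ) : (cellBox n).card = n ^ 2 := by
  simp [cellBox, sq]

theorem ediv_eq_iff_mem_Ico {m y k : ℤ} (hm : 0 < m) :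
    y / m = k ↔ m * k ≤ y ∧ y < m * k + m := by
  rw [show m * k + m = (k + 1) * m by ring, mul_comm m k, ← Int.le_ediv_iff_mul_le hm,
    ← Int.ediv_lt_iff_lt_mul hm]
  omega

/-- The boxes `s + m k + [0,m)²` tile the plane: integer division finds the index `k` of the tile
that contains a given cell. -/
theorem mem_tile_iff {s k x : ℤ × ℤ} {m : ℕ} (hm : 0 < m) :
    x ∈ (s + (m : ℤ) • k) +ᵥ cellBox m ↔
      ((x.1 - s.1) / m, (x.2 - s.2) / m) = k := by
  have hm' : (0 : ℤ) < m := by exact_mod_cast hm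
  rw [mem_vadd_cellBox, Prod.ext_iff]
  simp only [ediv_eq_iff_mem_Ico hm', Prod.fst_add, Prod.snd_add, Prod.smul_fst, Prod.smul_snd,
    smul_eq_mul]
  refine and_congr ?_ ?_ <;> constructor <;> rintro ⟨h1, h2⟩ <;> constructor <;> linarith

/-- Cutting a box of side `q * m` into `q²` boxes of side `m`. -/
theorem le_sum_tiles {F : Finset (ℤ × ℤ) → ℝ} (h0 : F ∅ ≤ 0)
    (hF : ∀ S T, Disjoint S T → F (S ∪ T) ≤ F S + F T) (s : ℤ × ℤ) (q : ℕ) {m : ℕ} (hm : 0 < m) :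
    F (s +ᵥ cellBox (q * m)) ≤ ∑ k ∈ cellBox q, F ((s + (m : ℤ) • k) +ᵥ cellBox m) := by
  have hunion : ∀ K : Finset (ℤ × ℤ),
      F (K.biUnion fun k => (s + (m : ℤ) • k) +ᵥ cellBox m) ≤
        ∑ k ∈ K, F ((s + (m : ℤ) • k) +ᵥ cellBox m) := fun K => by
    induction K using Finset.induction_on with
    | empty => simpa using h0
    | insert a K ha ih =>
      rw [Finset.biUnion_insert, Finset.sum_insert ha]
      refine (hF _ _ ?_).trans (by linarith)
      rw [Finset.disjoint_biUnion_right]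
      intro k hk
      rw [Finset.disjoint_left]
      intro x hx hx'
      rw [mem_tile_iff hm] at hx hx'
      exact ha (hx.symm.trans hx' ▸ hk)
  convert hunion (cellBox q) using 2
  ext x
  have hm' : (0 : ℤ) < m := by exact_mod_cast hm
  simp only [Finset.mem_biUnion, mem_tile_iff hm, exists_eq_right', mem_vadd_cellBox]
  simp only [cellBox, Finset.mem_product, Finset.mem_Ico, Int.le_ediv_iff_mul_le hm',
    Int.ediv_lt_iff_lt_mul hm', zero_mul]
  push_cast
  refine and_congr ?_ ?_ <;> constructor <;> rintro ⟨h1, h2⟩ <;> constructor <;> linarith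

/-- The two-dimensional Fekete lemma for monotone functions of the side length. -/
theorem exists_tendsto_div_sq {u : ℕ → ℝ} (h0 : ∀ n, 0 ≤ u n) (hmono : Monotone u)
    (hmul : ∀ q m, 0 < m → u (q * m) ≤ q ^ 2 * u m) :
    ∃ l, Tendsto (fun n => u n / (n : ℝ) ^ 2) atTop (𝓝 l) ∧ ∀ m, 0 < m → l * m ^ 2 ≤ u m := by
  set S : Set ℝ := (fun m : ℕ => u m / (m : ℝ) ^ 2) '' Set.Ioi 0 with hS
  have hbdd : BddBelow S := ⟨0, by rintro _ ⟨m, _, rfl⟩; have := h0 m; positivity⟩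
  have hne : S.Nonempty := ⟨_, 1, by simp, rfl⟩
  have hle : ∀ m, 0 < m → sInf S ≤ u m / (m : ℝ) ^ 2 := fun m hm => csInf_le hbdd ⟨m, hm, rfl⟩
  refine ⟨sInf S, tendsto_order.2 ⟨fun a ha => ?_, fun a ha => ?_⟩, fun m hm => ?_⟩
  · filter_upwards [eventually_gt_atTop 0] with n hn using ha.trans_le (hle n hn)
  · obtain ⟨_, ⟨m, hm, rfl⟩, hma⟩ := exists_lt_of_csInf_lt hne ha
    have hm : 0 < m := hm
    have hm' : (0 : ℝ) < m := by exact_mod_cast hm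
    have hlim : Tendsto (fun n : ℕ => (1 / (m : ℝ) + 1 / (n : ℝ)) ^ 2 * u m) atTop
        (𝓝 ((1 / (m : ℝ) + 0) ^ 2 * u m)) :=
      ((tendsto_const_nhds.add tendsto_one_div_atTop_nhds_zero_nat).pow 2).mul_const _
    have hlt : (1 / (m : ℝ) + 0) ^ 2 * u m < a :=
      (show _ = u m / (m : ℝ) ^ 2 by ring).trans_lt hma
    filter_upwards [(tendsto_order.1 hlim).2 a hlt, eventually_gt_atTop 0] with n hn hn0
    have hn' : (0 : ℝ) < n := by exact_mod_cast hn0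
    refine lt_of_le_of_lt ?_ hn
    -- `n / m + 1` boxes of side `m` in each direction cover the box of side `n`
    have h1 : u n ≤ ((n / m + 1 : ℕ) : ℝ) ^ 2 * u m := by
      refine (hmono ?_).trans (hmul _ m hm)
      exact (Nat.lt_mul_of_div_lt (Nat.lt_succ_self _) hm).le.trans (by rw [mul_comm])
    have h2 : ((n / m + 1 : ℕ) : ℝ) ≤ n * (1 / (m : ℝ) + 1 / (n : ℝ)) := by
      push_cast
      rw [mul_add, mul_one_div, mul_one_div, div_self hn'.ne']
      gcongr
      exact Nat.cast_div_le
    rw [div_le_iff₀ (by positivity)]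
    calc u n ≤ _ := h1
      _ ≤ (n * (1 / (m : ℝ) + 1 / (n : ℝ))) ^ 2 * u m := by
        have := h0 m
        gcongr
      _ = _ := by ring
  · have := hle m hm
    rwa [le_div_iff₀ (by positivity)] at this

variable {ι : Type*}

theorem translateSites_product (t : ℤ × ℤ) (T : Finset (ℤ × ℤ)) (J : Finset ι) :
    translateSites t (T ×ˢ J) = (t +ᵥ T) ×ˢ J := by
  ext v
  rw [mem_translateSites, Finset.mem_product, Finset.mem_product, ← Finset.neg_vadd_mem_iff,
    vadd_eq_add, neg_add_eq_sub]

open scoped Classical in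
/-- A translation invariant, monotone, subadditive function of finite windows has a density, along
the sites of boxes whose position in the cell belongs to `J`; the density is an infimum. -/
theorem exists_tendsto_density {G : Finset (Site ι) → ℝ} (h0 : G ∅ = 0)
    (hmono : ∀ A B, A ⊆ B → G A ≤ G B) (hunion : ∀ A B, G (A ∪ B) ≤ G A + G B)
    (htrans : ∀ t A, G (translateSites t A) = G A) {J : Finset ι} (hJ : J.Nonempty) :
    ∃ l, Tendsto (fun n => G (cellBox n ×ˢ J) / ((cellBox n ×ˢ J).card : ℝ)) atTop (𝓝 l) ∧
      ∀ m, 0 < m → l * (cellBox m ×ˢ J).card ≤ G (cellBox m ×ˢ J) := by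
  have hbox : Monotone cellBox := fun m n h => by
    have : (m : ℤ) ≤ n := by exact_mod_cast h
    exact Finset.product_subset_product (Finset.Ico_subset_Ico le_rfl this)
      (Finset.Ico_subset_Ico le_rfl this)
  obtain ⟨l, hl, hlm⟩ := exists_tendsto_div_sq (u := fun n => G (cellBox n ×ˢ J))
    (fun n => h0 ▸ hmono _ _ (Finset.empty_subset _))
    (fun m n h => hmono _ _ (Finset.product_subset_product (hbox h) subset_rfl))
    (fun q m hm => by
      have := le_sum_tiles (F := fun T => G (T ×ˢ J)) (by simp [h0])
        (fun S T _ => by rw [Finset.union_product]; exact hunion _ _) 0 q hm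
      simpa [← translateSites_product, htrans, card_cellBox] using this)
  have hJ' : (0 : ℝ) < J.card := by exact_mod_cast hJ.card_pos
  refine ⟨l / J.card, ?_, fun m hm => ?_⟩
  · refine (hl.div_const (J.card : ℝ)).congr fun n => ?_
    rw [Finset.card_product, card_cellBox, div_div]
    push_cast
    rfl
  · rw [Finset.card_product, card_cellBox]
    push_cast
    rw [div_mul_eq_mul_div, div_le_iff₀ hJ', ← mul_assoc]
    exact mul_le_mul_of_nonneg_right (hlm m hm) hJ'.le

theorem tendsto_div_sq_of_density {u : ℕ → ℝ} {J : Finset ι} (hJ : J.Nonempty) {l : ℝ}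
    (h : Tendsto (fun n => u n / ((cellBox n ×ˢ J).card : ℝ)) atTop (𝓝 l)) :
    Tendsto (fun n => u n / (n : ℝ) ^ 2) atTop (𝓝 (l * J.card)) := by
  have hJ' : (J.card : ℝ) ≠ 0 := by exact_mod_cast hJ.card_pos.ne'
  refine (h.mul_const (J.card : ℝ)).congr fun n => ?_
  rw [Finset.card_product, card_cellBox, Nat.cast_mul, ← div_div, div_mul_cancel₀ _ hJ',
    Nat.cast_pow]

theorem tendsto_boundary_div_sq (r : ℕ) (a : ℝ) :
    Tendsto (fun n : ℕ => (((n : ℝ) + 2 * r) ^ 2 - (n : ℝ) ^ 2) * a / (n : ℝ) ^ 2) atTop (𝓝 0) := by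
  have h1 := tendsto_one_div_atTop_nhds_zero_nat (𝕜 := ℝ)
  have h2 : Tendsto (fun n : ℕ => ((1 + 2 * r * (1 / (n : ℝ))) ^ 2 - 1) * a) atTop
      (𝓝 (((1 + 2 * r * 0) ^ 2 - 1) * a)) :=
    (((tendsto_const_nhds.add (h1.const_mul _)).pow 2).sub_const 1).mul_const _
  simp only [mul_zero, add_zero, one_pow, sub_self, zero_mul] at h2
  refine h2.congr' ?_
  filter_upwards [eventually_gt_atTop 0] with n hn
  have : (n : ℝ) ≠ 0 := by exact_mod_cast hn.ne'
  field_simp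

/-- The square `[-r,r]²` of cell vectors. -/
noncomputable def cellBall (r : ℕ) : Finset (ℤ × ℤ) :=
  Finset.Icc (-r : ℤ) r ×ˢ Finset.Icc (-r : ℤ) r

theorem subset_add_cellBall (r : ℕ) (T : Finset (ℤ × ℤ)) : T ⊆ T + cellBall r := fun x hx => by
  have h0 : (0 : ℤ × ℤ) ∈ cellBall r := by simp [cellBall]
  simpa using Finset.add_mem_add hx h0

theorem vadd_add_cellBall (t : ℤ × ℤ) (T : Finset (ℤ × ℤ)) (r : ℕ) :
    (t +ᵥ T) + cellBall r = t +ᵥ (T + cellBall r) := by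
  rw [← Finset.singleton_vadd, ← Finset.singleton_vadd, vadd_eq_add, vadd_eq_add, add_assoc]

theorem card_cellBox_add_le (r n : ℕ) : (cellBox n + cellBall r).card ≤ (n + 2 * r) ^ 2 := by
  have : cellBox n + cellBall r ⊆ ((-r, -r) : ℤ × ℤ) +ᵥ cellBox (n + 2 * r) := by
    intro x hx
    obtain ⟨a, ha, b, hb, rfl⟩ := Finset.mem_add.1 hx
    rw [mem_vadd_cellBox]
    simp only [cellBox, cellBall, Finset.mem_product, Finset.mem_Ico, Finset.mem_Icc] at ha hb
    push_cast
    simp only [Prod.fst_add, Prod.snd_add]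
    omega
  refine (Finset.card_le_card this).trans ?_
  rw [Finset.card_vadd_finset, card_cellBox]

end Boxes

namespace SplitLattice

variable {ι : Type*} [Fintype ι] (L : SplitLattice ι)

theorem hardCore_nonempty : L.hardCore.Nonempty := ⟨fun _ => false, by simp [hardCore]⟩

theorem shift_mem_hardCore (t : ℤ × ℤ) (x : Config ι) (hx : x ∈ L.hardCore) :
    shift t x ∈ L.hardCore := fun _ _ h => hx _ _ (L.adj_translate t _ _ _ _ h)

/-- The topological entropy exists, and `|B_m|` times it is a lower bound for the logarithm of the
number of patterns on `B_m`. -/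
theorem tendsto_topRate [Nonempty ι] : Tendsto L.topRate atTop (𝓝 L.topEntropy) ∧
    ∀ m, 0 < m → L.topEntropy * (siteBox ι m).card ≤
      Real.log (patternCount L.hardCore (siteBox ι m)) := by
  classical
  obtain ⟨l, hl, hlm⟩ := exists_tendsto_density
    (G := fun A : Finset (Site ι) => Real.log (patternCount L.hardCore A))
    (le_antisymm (by simpa using log_patternCount_le _ L.hardCore_nonempty ∅)
      (log_patternCount_nonneg _ _))
    (fun A B h => log_patternCount_mono _ L.hardCore_nonempty h)
    (fun A B => log_patternCount_union_le _ L.hardCore_nonempty A B)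
    (fun t A => by rw [patternCount_translateSites L.shift_mem_hardCore])
    (J := Finset.univ) Finset.univ_nonempty
  have hl : Tendsto L.topRate atTop (𝓝 l) := hl
  rw [show L.topEntropy = l from hl.limUnder_eq]
  exact ⟨hl, hlm⟩

/-- The even positions in a cell. -/
def evens : Finset ι := Finset.univ.filter fun i => L.isEven i = true

/-- The odd positions in a cell. -/
def odds : Finset ι := Finset.univ.filter fun i => L.isEven i = false

theorem card_evens : L.evens.card = L.odds.card := L.equalDensity

theorem two_mul_card_odds : 2 * L.odds.card = Fintype.card ι := by
  have := Finset.card_filter_add_card_filter_not (s := Finset.univ) fun i => L.isEven i = true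
  simp only [Bool.not_eq_true, Finset.card_univ] at this
  rw [← this, two_mul]
  exact congrArg (· + L.odds.card) L.card_evens.symm

theorem card_odds_pos [Nonempty ι] : 0 < L.odds.card := by
  have := L.two_mul_card_odds
  have := Fintype.card_pos (α := ι)
  omega

theorem evenBox_eq (n : ℕ) : L.evenBox n = cellBox n ×ˢ L.evens := by
  ext v; simp [evenBox, siteBox, cellBox, evens]

theorem tendsto_evenRate [Nonempty ι] (μ : Measure (Config ι)) [IsProbabilityMeasure μ]
    (hinv : ∀ t, μ.map (shift t) = μ) :
    Tendsto (L.evenRate μ) atTop (𝓝 (L.evenEntropy μ)) := by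
  classical
  obtain ⟨l, hl, -⟩ := exists_tendsto_density (G := shannonEntropy μ) (shannonEntropy_empty μ)
    (fun A B h => shannonEntropy_mono μ h) (fun A B => shannonEntropy_union_le μ A B)
    (fun t A => by rw [← shannonEntropy_map_shift, hinv])
    (J := L.evens) (Finset.card_pos.1 (by rw [card_evens]; exact L.card_odds_pos))
  have hl : Tendsto (L.evenRate μ) atTop (𝓝 l) := by
    simp only [← evenBox_eq] at hl
    exact hl
  rwa [show L.evenEntropy μ = l from hl.limUnder_eq]

end SplitLattice

/-! ### The law with refilled odd sites -/

instance isProbabilityMeasure_fairCoins {ι : Type*} : IsProbabilityMeasure (fairCoins ι) := by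
  unfold fairCoins; infer_instance

theorem fairCoins_real_pi {ι : Type*} (C : Finset (Site ι)) (t : Site ι → Set Bool) :
    (fairCoins ι).real (Set.pi C t) =
      ∏ o ∈ C, ((PMF.uniformOfFintype Bool).toMeasure).real (t o) := by
  rw [measureReal_def, fairCoins,
    Measure.infinitePi_pi _ fun _ _ => MeasurableSet.of_discrete, ENNReal.toReal_prod]
  rfl

namespace SplitLattice

variable {ι : Type*} [Fintype ι] (L : SplitLattice ι)

theorem fill_mem_hardCore (x ω : Config ι) : L.fill x ω ∈ L.hardCore := by
  have key : ∀ u v, L.graph.Adj u v → L.isEven u.2 = true → L.isEven v.2 = false →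
      ¬ (L.fill x ω u = true ∧ L.fill x ω v = true) := fun u v huv hu hv ⟨h1, h2⟩ => by
    have hb : x ∈ L.unblocked v := by
      by_contra hb
      simp [fill, hv, hb] at h2
    have := hb u huv.symm
    simp [fill, hu, this] at h1
  intro u v huv h
  have hne := L.bipartite u v huv
  cases hu : L.isEven u.2
  · exact key v u huv.symm (by rw [hu] at hne; simpa using hne.symm) hu h.symm
  · exact key u v huv hu (by rw [hu] at hne; simpa using hne.symm) h

theorem isEven_of_adj_odd {o v : Site ι} (ho : L.isEven o.2 = false) (h : L.graph.Adj o v) :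
    L.isEven v.2 = true := by
  have := L.bipartite o v h
  rw [ho] at this
  simpa using this.symm

theorem mem_unblocked_congr {o : Site ι} {x y : Config ι}
    (h : ∀ v, L.graph.Adj o v → x v = y v) : x ∈ L.unblocked o ↔ y ∈ L.unblocked o :=
  forall₂_congr fun v hv => by rw [h v hv]

theorem fill_mem_unblocked_iff {o : Site ι} (ho : L.isEven o.2 = false) (x ω : Config ι) :
    L.fill x ω ∈ L.unblocked o ↔ x ∈ L.unblocked o :=
  L.mem_unblocked_congr fun v hv => by simp [fill, L.isEven_of_adj_odd ho hv]

theorem measurableSet_unblocked (o : Site ι) : MeasurableSet (L.unblocked o) := by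
  have : L.unblocked o = ⋂ v, ⋂ (_ : L.graph.Adj o v), (fun x : Config ι => x v) ⁻¹' {false} := by
    ext x; simp [unblocked]
  rw [this]
  exact .iInter fun v => .iInter fun _ => measurable_pi_apply v (measurableSet_singleton _)

theorem measurable_fill : Measurable fun p : Config ι × Config ι => L.fill p.1 p.2 := by
  classical
  refine measurable_pi_iff.2 fun v => ?_
  unfold fill
  split_ifs with hv
  · fun_prop
  · exact Measurable.ite (measurable_fst (L.measurableSet_unblocked v)) (by fun_prop) (by fun_prop)

instance isProbabilityMeasure_fillIn (μ : Measure (Config ι)) [IsProbabilityMeasure μ] :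
    IsProbabilityMeasure (L.fillIn μ) :=
  Measure.isProbabilityMeasure_map L.measurable_fill.aemeasurable

theorem measurableSet_hardCore : MeasurableSet L.hardCore := by
  have : L.hardCore = ⋂ u, ⋂ v, ⋂ (_ : L.graph.Adj u v),
      ((fun x : Config ι => x u) ⁻¹' {true} ∩ (fun x : Config ι => x v) ⁻¹' {true})ᶜ := by
    ext x; simp [hardCore]
  rw [this]
  exact .iInter fun u => .iInter fun v => .iInter fun _ =>
    ((measurable_pi_apply u (measurableSet_singleton _)).inter
      (measurable_pi_apply v (measurableSet_singleton _))).compl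

theorem ae_mem_hardCore_fillIn (μ : Measure (Config ι)) : ∀ᵐ x ∂L.fillIn μ, x ∈ L.hardCore :=
  (ae_map_iff L.measurable_fill.aemeasurable L.measurableSet_hardCore).2
    (Eventually.of_forall fun p => L.fill_mem_hardCore p.1 p.2)

theorem fillIn_real_unblocked (μ : Measure (Config ι)) [IsProbabilityMeasure μ] {o : Site ι}
    (ho : L.isEven o.2 = false) :
    (L.fillIn μ).real (L.unblocked o) = μ.real (L.unblocked o) := by
  rw [fillIn, map_measureReal_apply L.measurable_fill (L.measurableSet_unblocked o)]
  have : (fun p : Config ι × Config ι => L.fill p.1 p.2) ⁻¹' L.unblocked o =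
      L.unblocked o ×ˢ Set.univ := by
    ext p
    simpa using L.fill_mem_unblocked_iff ho p.1 p.2
  rw [this, measureReal_prod_prod]
  simp

open scoped Classical in
/-- The conditional probability that refilling puts the value `x o` on the odd site `o`, given
that the even configuration is that of `x`. -/
noncomputable def fillWeight (o : Site ι) (x : Config ι) : ℝ :=
  if x ∈ L.unblocked o then 1 / 2 else if x o = false then 1 else 0

/-- A window `C ∪ E` is *closed* if `C` consists of odd sites, `E` of even sites, and `E` contains
all neighbours of the sites in `C`. -/
structure IsClosedWindow (C E : Finset (Site ι)) : Prop where
  odd : ∀ v ∈ C, L.isEven v.2 = false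
  even : ∀ v ∈ E, L.isEven v.2 = true
  mem_of_adj : ∀ o ∈ C, ∀ v, L.graph.Adj o v → v ∈ E

variable {L} {C E : Finset (Site ι)}

theorem IsClosedWindow.disjoint (h : L.IsClosedWindow C E) : Disjoint C E :=
  Finset.disjoint_left.2 fun v hC hE => by simpa [h.odd v hC] using h.even v hE

open scoped Classical in
/-- The mass that the refilled law gives to a cylinder on a closed window. -/
theorem IsClosedWindow.fillIn_real_cyl (h : L.IsClosedWindow C E) (μ : Measure (Config ι))
    [IsProbabilityMeasure μ] (x : Config ι) :
    (L.fillIn μ).real (cyl (C ∪ E) x) = μ.real (cyl E x) * ∏ o ∈ C, L.fillWeight o x := by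
  rw [fillIn, map_measureReal_apply L.measurable_fill (measurableSet_cyl _ _)]
  have hpre : (fun p : Config ι × Config ι => L.fill p.1 p.2) ⁻¹' cyl (C ∪ E) x =
      cyl E x ×ˢ Set.pi C fun o => {b | (if x ∈ L.unblocked o then b else false) = x o} := by
    ext ⟨y, ω⟩
    simp only [cyl, Set.mem_preimage, Finset.mem_union, or_imp, forall_and, Set.mem_prod,
      Set.mem_pi, Finset.mem_coe, Set.mem_ofPred_eq]
    rw [and_comm, show (∀ v ∈ E, L.fill y ω v = x v) ↔ ∀ v ∈ E, y v = x v from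
      forall₂_congr fun v hv => by simp [fill, h.even v hv]]
    refine and_congr_right fun hy => forall₂_congr fun v hv => ?_
    have := L.mem_unblocked_congr (o := v) fun w hw => hy w (h.mem_of_adj v hv w hw)
    simp [fill, h.odd v hv, this]
  rw [hpre, measureReal_prod_prod, fairCoins_real_pi]
  congr 1
  refine Finset.prod_congr rfl fun o _ => ?_
  unfold fillWeight
  split_ifs with h1 h2
  · have : {b | b = x o} = {x o} := rfl
    rw [this, measureReal_def, PMF.toMeasure_apply_singleton _ _ (measurableSet_singleton _)]
    simp
  · rw [Set.eq_univ_of_forall fun b => (show b ∈ {b : Bool | false = x o} from h2.symm)]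
    exact probReal_univ
  · have h2 : x o = true := by simpa using h2
    simp [h2]


theorem IsClosedWindow.fillIn_real_cyl_even (h : L.IsClosedWindow C E) (μ : Measure (Config ι))
    [IsProbabilityMeasure μ] (x : Config ι) :
    (L.fillIn μ).real (cyl E x) = μ.real (cyl E x) := by
  have h' : L.IsClosedWindow ∅ E := ⟨by simp, h.even, by simp⟩
  simpa using h'.fillIn_real_cyl μ x

open scoped Classical in
theorem neg_log_fillWeight {x : Config ι} (hx : x ∈ L.hardCore) (o : Site ι) :
    -Real.log (L.fillWeight o x) = (L.unblocked o).indicator 1 x * Real.log 2 := by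
  unfold fillWeight
  by_cases hu : x ∈ L.unblocked o
  · simp [hu]
  · have h0 : x o = false := by
      simp only [unblocked, Set.mem_ofPred_eq, not_forall] at hu
      obtain ⟨v, hv, hxv⟩ := hu
      have := hx o v hv
      simp_all
    simp [hu, h0]

theorem fillWeight_ne_zero {x : Config ι} (hx : x ∈ L.hardCore) (o : Site ι) :
    L.fillWeight o x ≠ 0 := by
  unfold fillWeight
  split_ifs with hu h0
  · norm_num
  · norm_num
  · exfalso
    simp only [unblocked, Set.mem_ofPred_eq, not_forall] at hu
    obtain ⟨v, hv, hxv⟩ := hu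
    have := hx o v hv
    simp_all

open scoped Classical in
/-- The cross entropy, relative to the refilled law, of a hard core law with the same even
marginal. -/
theorem IsClosedWindow.cross_fillIn (h : L.IsClosedWindow C E) (μ ν : Measure (Config ι))
    [IsProbabilityMeasure μ] [IsProbabilityMeasure ν] (hν : ∀ᵐ x ∂ν, x ∈ L.hardCore)
    (heven : ∀ x, ν.real (cyl E x) = μ.real (cyl E x)) :
    (∀ᵐ x ∂ν, (L.fillIn μ).real (cyl (C ∪ E) x) ≠ 0) ∧
    ∫ x, -Real.log ((L.fillIn μ).real (cyl (C ∪ E) x)) ∂ν =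
      shannonEntropy ν E + (∑ o ∈ C, ν.real (L.unblocked o)) * Real.log 2 := by
  simp only [h.fillIn_real_cyl, ← heven]
  have hpos := ae_pos_cyl ν E
  have hI : ∀ o, Integrable (fun x => (L.unblocked o).indicator (1 : Config ι → ℝ) x) ν := fun o =>
    (integrable_indicator_iff (L.measurableSet_unblocked o)).2 (integrable_const 1).integrableOn
  constructor
  · filter_upwards [hν, hpos] with x hx hx'
    exact mul_ne_zero hx'.ne' (Finset.prod_ne_zero_iff.2 fun o _ => fillWeight_ne_zero hx o)
  · have : (fun x => -Real.log (ν.real (cyl E x) * ∏ o ∈ C, L.fillWeight o x)) =ᵐ[ν]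
        fun x => -Real.log (ν.real (cyl E x)) +
          ∑ o ∈ C, (L.unblocked o).indicator 1 x * Real.log 2 := by
      filter_upwards [hν, hpos] with x hx hx'
      rw [Real.log_mul hx'.ne' (Finset.prod_ne_zero_iff.2 fun o _ => fillWeight_ne_zero hx o),
        Real.log_prod fun o _ => fillWeight_ne_zero hx o, neg_add, ← Finset.sum_neg_distrib]
      simp only [neg_log_fillWeight hx]
    rw [integral_congr_ae this, integral_add (integrable_log_cyl _ _ _)
      (integrable_finsetSum _ fun o _ => (hI o).mul_const _),
      integral_finsetSum _ fun o _ => (hI o).mul_const _, shannonEntropy_eq_integral,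
      Finset.sum_mul]
    congr 1
    refine Finset.sum_congr rfl fun o _ => ?_
    rw [integral_mul_const, integral_indicator_one (L.measurableSet_unblocked o)]

/-! ### The entropy deficit of a hard core law -/

variable (L) in
open scoped Classical in
/-- The amount by which the entropy of `μ` on the window `C ∪ E` falls short of that of the
refilled law.  For a closed window and a hard core law `μ` this is the relative entropy of `μ` with
respect to the refilled law. -/
noncomputable def deficit (μ : Measure (Config ι)) (C E : Finset (Site ι)) : ℝ :=
  shannonEntropy μ E + (∑ o ∈ C, μ.real (L.unblocked o)) * Real.log 2 - shannonEntropy μ (C ∪ E)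

open scoped Classical in
theorem IsClosedWindow.deficit_nonneg (h : L.IsClosedWindow C E) (μ : Measure (Config ι))
    [IsProbabilityMeasure μ] (hμ : ∀ᵐ x ∂μ, x ∈ L.hardCore) : 0 ≤ L.deficit μ C E := by
  obtain ⟨hpos, hcross⟩ := h.cross_fillIn μ μ hμ fun _ => rfl
  have := (shannonEntropy_le_cross μ _ _ hpos).1
  unfold deficit
  linarith

open scoped Classical in
theorem IsClosedWindow.real_cyl_eq_of_deficit_le (h : L.IsClosedWindow C E)
    (μ : Measure (Config ι)) [IsProbabilityMeasure μ] (hμ : ∀ᵐ x ∂μ, x ∈ L.hardCore)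
    (hd : L.deficit μ C E ≤ 0) (x : Config ι) :
    μ.real (cyl (C ∪ E) x) = (L.fillIn μ).real (cyl (C ∪ E) x) := by
  obtain ⟨hpos, hcross⟩ := h.cross_fillIn μ μ hμ fun _ => rfl
  refine (shannonEntropy_le_cross μ _ _ hpos).2 ?_ x
  unfold deficit at hd
  linarith

open scoped Classical in
theorem IsClosedWindow.shannonEntropy_fillIn (h : L.IsClosedWindow C E)
    (μ : Measure (Config ι)) [IsProbabilityMeasure μ] :
    shannonEntropy (L.fillIn μ) (C ∪ E) =
      shannonEntropy μ E + (∑ o ∈ C, μ.real (L.unblocked o)) * Real.log 2 := by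
  have := (h.cross_fillIn μ (L.fillIn μ) (L.ae_mem_hardCore_fillIn μ)
    (h.fillIn_real_cyl_even μ)).2
  rw [← shannonEntropy_eq_integral] at this
  rw [this, Finset.sum_congr rfl fun o ho => L.fillIn_real_unblocked μ (h.odd o ho)]
  congr 1
  simp only [shannonEntropy_eq_integral, h.fillIn_real_cyl_even]
  -- the information of the cylinder around `x` depends on the even part of `x` only
  have hs : ∀ ρ : Measure (Config ι), ∀ [IsProbabilityMeasure ρ],
      ∫ x, -Real.log (μ.real (cyl E x)) ∂ρ =
        ∑ a : E → Bool, ρ.real (E.restrict ⁻¹' {a}) *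
          -Real.log (μ.real (E.restrict ⁻¹' {a})) := fun ρ _ => by
    simpa only [restrict_preimage_singleton] using integral_comp_of_fintype ρ
      (measurable_restrict E) fun a => -Real.log (μ.real (E.restrict ⁻¹' {a}))
  rw [hs, hs]
  refine Finset.sum_congr rfl fun a _ => ?_
  obtain ⟨x, rfl⟩ := exists_restrict_eq a
  simp only [restrict_preimage_singleton, h.fillIn_real_cyl_even]

open scoped Classical in
/-- The deficit is superadditive: by strong subadditivity, the odd sites of two windows are worth
no more together than separately. -/
theorem IsClosedWindow.deficit_add_le {C' E' : Finset (Site ι)} (h : L.IsClosedWindow C E)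
    (h' : L.IsClosedWindow C' E') (hC : Disjoint C C') (μ : Measure (Config ι))
    [IsProbabilityMeasure μ] :
    L.deficit μ C E + L.deficit μ C' E' ≤ L.deficit μ (C ∪ C') (E ∪ E') := by
  have hCE : ∀ v ∈ C, v ∉ E ∧ v ∉ E' ∧ v ∉ C' := fun v hv =>
    ⟨Finset.disjoint_left.1 h.disjoint hv,
      fun hv' => by simpa [h.odd v hv] using h'.even v hv', Finset.disjoint_left.1 hC hv⟩
  have hCE' : ∀ v ∈ C', v ∉ E ∧ v ∉ E' := fun v hv =>
    ⟨fun hv' => by simpa [h'.odd v hv] using h.even v hv',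
      Finset.disjoint_left.1 h'.disjoint hv⟩
  have s1 := shannonEntropy_submodular μ (C ∪ (E ∪ E')) (C' ∪ (E ∪ E'))
  have s2 := shannonEntropy_submodular μ (C ∪ E) (E ∪ E')
  have s3 := shannonEntropy_submodular μ (C' ∪ E') (E ∪ E')
  have e1 : (C ∪ (E ∪ E')) ∪ (C' ∪ (E ∪ E')) = C ∪ C' ∪ (E ∪ E') := by grind
  have e2 : (C ∪ (E ∪ E')) ∩ (C' ∪ (E ∪ E')) = E ∪ E' := by grind
  have e3 : (C ∪ E) ∪ (E ∪ E') = C ∪ (E ∪ E') := by grind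
  have e4 : (C ∪ E) ∩ (E ∪ E') = E := by grind
  have e5 : (C' ∪ E') ∪ (E ∪ E') = C' ∪ (E ∪ E') := by grind
  have e6 : (C' ∪ E') ∩ (E ∪ E') = E' := by grind
  rw [e1, e2] at s1
  rw [e3, e4] at s2
  rw [e5, e6] at s3
  unfold deficit
  rw [Finset.sum_union hC]
  linarith

end SplitLattice

namespace SplitLattice

variable {ι : Type*} [Fintype ι] (L : SplitLattice ι)

/-! ### Rigidity of the measures of maximal entropy -/

section Rigidity

open scoped Pointwise

theorem adj_translate_iff (t u v : ℤ × ℤ) (i j : ι) :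
    L.graph.Adj (t + u, i) (t + v, j) ↔ L.graph.Adj (u, i) (v, j) :=
  ⟨fun h => by simpa using L.adj_translate (-t) _ _ _ _ h, L.adj_translate t u v i j⟩

theorem shift_mem_unblocked_iff (t u : ℤ × ℤ) (i : ι) (x : Config ι) :
    shift t x ∈ L.unblocked (u, i) ↔ x ∈ L.unblocked (t + u, i) := by
  constructor
  · rintro h ⟨v, j⟩ hv
    have := h (-t + v, j) (by rw [← L.adj_translate_iff t]; simpa using hv)
    simpa [shift] using this
  · rintro h ⟨v, j⟩ hv
    exact h (t + v, j) ((L.adj_translate_iff t _ _ _ _).2 hv)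

theorem real_unblocked_eq {μ : Measure (Config ι)} (hinv : ∀ t, μ.map (shift t) = μ)
    (u : ℤ × ℤ) (i : ι) : μ.real (L.unblocked (u, i)) = μ.real (L.unblocked (0, i)) := by
  conv_rhs => rw [← hinv u]
  rw [map_measureReal_apply (measurable_shift u) (L.measurableSet_unblocked _)]
  congr 1
  ext x
  simpa using (L.shift_mem_unblocked_iff u 0 i x).symm

/-- By translation invariance and local finiteness, the interaction has finite range. -/
theorem exists_range : ∃ r : ℕ, ∀ u i v j, L.graph.Adj (u, i) (v, j) → v - u ∈ cellBall r := by
  have hfin : (⋃ i, L.graph.neighborSet (0, i)).Finite :=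
    Set.finite_iUnion fun i => L.locallyFinite _
  obtain ⟨r, hr⟩ := (hfin.image fun v : Site ι => max v.1.1.natAbs v.1.2.natAbs).bddAbove
  refine ⟨r, fun u i v j h => ?_⟩
  have := hr (Set.mem_image_of_mem _ (Set.mem_iUnion.2 ⟨i, show L.graph.Adj (0, i) (v - u, j) by
    rw [← L.adj_translate_iff u]; simpa using h⟩))
  simp only [Prod.fst_sub, Prod.snd_sub] at this
  simp only [cellBall, Finset.mem_product, Finset.mem_Icc, Prod.fst_sub, Prod.snd_sub]
  omega

theorem isClosedWindow {r : ℕ} (hr : ∀ u i v j, L.graph.Adj (u, i) (v, j) → v - u ∈ cellBall r)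
    (T : Finset (ℤ × ℤ)) :
    L.IsClosedWindow (T ×ˢ L.odds) ((T + cellBall r) ×ˢ L.evens) where
  odd v hv := by simpa [odds] using (Finset.mem_product.1 hv).2
  even v hv := by simpa [evens] using (Finset.mem_product.1 hv).2
  mem_of_adj o ho v hv := by
    have ho := Finset.mem_product.1 ho
    refine Finset.mem_product.2 ⟨?_, ?_⟩
    · have := Finset.add_mem_add ho.1 (hr _ _ _ _ hv)
      simpa using this
    · simpa [evens] using L.isEven_of_adj_odd (by simpa [odds] using ho.2) hv

theorem sum_real_unblocked {μ : Measure (Config ι)} (hinv : ∀ t, μ.map (shift t) = μ)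
    (T : Finset (ℤ × ℤ)) : ∑ o ∈ T ×ˢ L.odds, μ.real (L.unblocked o) =
      T.card * ∑ i ∈ L.odds, μ.real (L.unblocked (0, i)) := by
  rw [Finset.sum_product]
  simp [L.real_unblocked_eq hinv]

open scoped Classical in
theorem deficit_translate {μ : Measure (Config ι)} [IsProbabilityMeasure μ]
    (hinv : ∀ t, μ.map (shift t) = μ) (t : ℤ × ℤ) (C E : Finset (Site ι)) :
    L.deficit μ (translateSites t C) (translateSites t E) = L.deficit μ C E := by
  have hu : translateSites t C ∪ translateSites t E = translateSites t (C ∪ E) := by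
    ext v; simp [mem_translateSites]
  have hs : ∑ o ∈ translateSites t C, μ.real (L.unblocked o) = ∑ o ∈ C, μ.real (L.unblocked o) := by
    rw [translateSites, Finset.sum_map]
    refine Finset.sum_congr rfl fun o _ => ?_
    rw [L.real_unblocked_eq hinv o.1 o.2]
    exact L.real_unblocked_eq hinv (t + o.1) o.2
  rw [deficit, deficit, hu, hs, ← shannonEntropy_map_shift, ← shannonEntropy_map_shift, hinv]

open scoped Classical in
/-- Enlarging the even part of a box by its halo of width `r` changes a monotone subadditive
quantity by at most a boundary term. -/
theorem le_add_boundary {G : Finset (Site ι) → ℝ}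
    (hG : ∀ A : Finset (Site ι), G A ≤ A.card * Real.log 2)
    (hmono : ∀ A B, A ⊆ B → G A ≤ G B)
    (hunion : ∀ A B, G (A ∪ B) ≤ G A + G B) (r n : ℕ)
    {A B : Finset (Site ι)} (h : ∀ v ∈ A, v ∉ B → v ∈ (cellBox n + cellBall r) ×ˢ L.evens ∧
      v.1 ∉ cellBox n) :
    G A ≤ G B + (((n : ℝ) + 2 * r) ^ 2 - (n : ℝ) ^ 2) * (L.odds.card * Real.log 2) := by
  set Z := ((cellBox n + cellBall r) \ cellBox n) ×ˢ L.evens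
  have hAB : A ⊆ B ∪ Z := fun v hv => by
    by_cases hB : v ∈ B
    · exact Finset.mem_union_left _ hB
    · obtain ⟨h1, h2⟩ := h v hv hB
      rw [Finset.mem_product] at h1
      exact Finset.mem_union_right _ (Finset.mem_product.2 ⟨Finset.mem_sdiff.2 ⟨h1.1, h2⟩, h1.2⟩)
  have hlog : 0 ≤ Real.log 2 := Real.log_nonneg (by norm_num)
  refine ((hmono _ _ hAB).trans (hunion _ _)).trans ?_
  gcongr
  refine (hG Z).trans ?_
  rw [Finset.card_product, Finset.card_sdiff_of_subset (subset_add_cellBall r _), card_cellBox,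
    card_evens, Nat.cast_mul, mul_assoc, Nat.cast_sub (by
      rw [← card_cellBox]; exact Finset.card_le_card (subset_add_cellBall r _))]
  gcongr
  · exact_mod_cast card_cellBox_add_le r n
  · push_cast; rfl

variable {L}

/-- The deficit of a measure of maximal entropy has density zero, which gives the entropy formula;
by superadditivity it then vanishes on every window based on a box. -/
theorem IsMaxEntropy.rigidity [Nonempty ι] {μ : Measure (Config ι)} (hμ : L.IsMaxEntropy μ)
    {r : ℕ} (hr : ∀ u i v j, L.graph.Adj (u, i) (v, j) → v - u ∈ cellBall r) :
    L.topEntropy = 1 / 2 * (L.evenEntropy μ + L.probUnblocked μ * Real.log 2) ∧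
    ∀ m, 0 < m → L.deficit μ (cellBox m ×ˢ L.odds) ((cellBox m + cellBall r) ×ˢ L.evens) ≤ 0 := by
  classical
  have := hμ.prob
  have hinv := hμ.invariant
  set k : ℝ := (L.odds.card : ℝ) with hk
  have hk0 : 0 < k := Nat.cast_pos.2 L.card_odds_pos
  have hcard : (Fintype.card ι : ℝ) = 2 * k := by
    rw [← L.two_mul_card_odds, Nat.cast_mul, Nat.cast_ofNat]
  set P : ℝ := ∑ i ∈ L.odds, μ.real (L.unblocked (0, i)) with hP
  have hprob : L.probUnblocked μ = P / k := rfl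
  set D : Finset (ℤ × ℤ) → ℝ :=
    fun T => L.deficit μ (T ×ˢ L.odds) ((T + cellBall r) ×ˢ L.evens) with hD
  have hDdef : ∀ T, D T = shannonEntropy μ ((T + cellBall r) ×ˢ L.evens) +
      T.card * P * Real.log 2 -
        shannonEntropy μ (T ×ˢ L.odds ∪ (T + cellBall r) ×ˢ L.evens) := fun T => by
    rw [hD]
    simp only [deficit, L.sum_real_unblocked hinv, hP]
  set b : ℕ → ℝ := fun n => (((n : ℝ) + 2 * r) ^ 2 - (n : ℝ) ^ 2) * (k * Real.log 2) with hb
  set H : ℕ → ℝ := fun n => shannonEntropy μ (siteBox ι n)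
  set He : ℕ → ℝ := fun n => shannonEntropy μ (L.evenBox n)
  have hsub : ∀ n, siteBox ι n ⊆ cellBox n ×ˢ L.odds ∪ (cellBox n + cellBall r) ×ˢ L.evens := by
    intro n v hv
    have hv1 : v.1 ∈ cellBox n := (Finset.mem_product.1 hv).1
    have := subset_add_cellBall r _ hv1
    cases he : L.isEven v.2 <;> simp [odds, evens, he, hv1, this]
  -- the upper bound for the deficit that comes from the entropy of the box
  have hup : ∀ n, D (cellBox n) ≤ He n + b n + (n : ℝ) ^ 2 * P * Real.log 2 - H n := fun n => by
    have h1 : shannonEntropy μ ((cellBox n + cellBall r) ×ˢ L.evens) ≤ He n + b n :=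
      L.le_add_boundary (shannonEntropy_le_card μ) (fun A B h => shannonEntropy_mono μ h)
        (fun A B => shannonEntropy_union_le μ A B) r n fun v hv hv' => ⟨hv, fun h => hv' (by
          rw [evenBox_eq]
          exact Finset.mem_product.2 ⟨h, (Finset.mem_product.1 hv).2⟩)⟩
    have h2 := shannonEntropy_mono μ (hsub n)
    rw [hDdef, card_cellBox]
    push_cast
    linarith
  -- the entropy of the refilled law is at most the logarithm of the number of patterns
  have hlow : ∀ n, He n + (n : ℝ) ^ 2 * P * Real.log 2 ≤
      Real.log (patternCount L.hardCore (siteBox ι n)) + b n := fun n => by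
    have h1 := shannonEntropy_le_log_patternCount (L.fillIn μ) (L.ae_mem_hardCore_fillIn μ)
      (cellBox n ×ˢ L.odds ∪ (cellBox n + cellBall r) ×ˢ L.evens)
    rw [(L.isClosedWindow hr _).shannonEntropy_fillIn μ, L.sum_real_unblocked hinv,
      card_cellBox] at h1
    have h2 : He n ≤ shannonEntropy μ ((cellBox n + cellBall r) ×ˢ L.evens) := by
      refine shannonEntropy_mono μ ?_
      rw [evenBox_eq]
      exact Finset.product_subset_product (subset_add_cellBall r _) subset_rfl
    have h3 := L.le_add_boundary
      (G := fun A => Real.log (patternCount L.hardCore A))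
      (log_patternCount_le _ L.hardCore_nonempty)
      (fun A B h => log_patternCount_mono _ L.hardCore_nonempty h)
      (fun A B => log_patternCount_union_le _ L.hardCore_nonempty A B) r n
      (A := cellBox n ×ˢ L.odds ∪ (cellBox n + cellBall r) ×ˢ L.evens) (B := siteBox ι n)
      fun v hv hv' => by
        have hnot : v.1 ∉ cellBox n := fun h => hv' (Finset.mem_product.2 ⟨h, Finset.mem_univ _⟩)
        refine ⟨(Finset.mem_union.1 hv).resolve_left fun h => hnot (Finset.mem_product.1 h).1, hnot⟩
    push_cast at h1
    simp only [← hk] at h3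
    linarith
  -- the limits per cell
  have hH : Tendsto (fun n => H n / (n : ℝ) ^ 2) atTop (𝓝 (L.topEntropy * (2 * k))) := by
    rw [← hcard]
    exact tendsto_div_sq_of_density Finset.univ_nonempty hμ.entropy
  have hN : Tendsto (fun n => Real.log (patternCount L.hardCore (siteBox ι n)) / (n : ℝ) ^ 2) atTop
      (𝓝 (L.topEntropy * (2 * k))) := by
    rw [← hcard]
    exact tendsto_div_sq_of_density Finset.univ_nonempty L.tendsto_topRate.1
  have hE : Tendsto (fun n => He n / (n : ℝ) ^ 2) atTop (𝓝 (L.evenEntropy μ * k)) := by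
    rw [hk, ← card_evens]
    refine tendsto_div_sq_of_density (Finset.card_pos.1 (L.card_evens ▸ L.card_odds_pos))
      ((L.tendsto_evenRate μ hinv).congr fun n => ?_)
    simp only [evenRate, He, evenBox_eq]
  have hB : Tendsto (fun n => b n / (n : ℝ) ^ 2) atTop (𝓝 0) := tendsto_boundary_div_sq r _
  have hPn : Tendsto (fun n : ℕ => (n : ℝ) ^ 2 * P * Real.log 2 / (n : ℝ) ^ 2) atTop
      (𝓝 (P * Real.log 2)) := by
    refine tendsto_const_nhds.congr' ?_
    filter_upwards [eventually_gt_atTop 0] with n hn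
    have : (n : ℝ) ≠ 0 := by exact_mod_cast hn.ne'
    field_simp
  set g : ℕ → ℝ := fun n => (He n + b n + (n : ℝ) ^ 2 * P * Real.log 2 - H n) / (n : ℝ) ^ 2 with hg
  have hglim : Tendsto g atTop
      (𝓝 (L.evenEntropy μ * k + 0 + P * Real.log 2 - L.topEntropy * (2 * k))) := by
    refine (((hE.add hB).add hPn).sub hH).congr fun n => ?_
    simp only [hg]
    ring
  have hge : 0 ≤ L.evenEntropy μ * k + 0 + P * Real.log 2 - L.topEntropy * (2 * k) := by
    refine ge_of_tendsto' hglim fun n => div_nonneg (le_trans ?_ (hup n)) (by positivity)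
    exact (L.isClosedWindow hr _).deficit_nonneg μ hμ.hardCore_ae
  have hle : L.evenEntropy μ * k + P * Real.log 2 ≤ L.topEntropy * (2 * k) + 0 := by
    refine le_of_tendsto_of_tendsto' (hE.add hPn) (hN.add hB) fun n => ?_
    rw [← add_div, ← add_div]
    exact div_le_div_of_nonneg_right (hlow n) (by positivity)
  have heq : L.evenEntropy μ * k + P * Real.log 2 = L.topEntropy * (2 * k) := by linarith
  refine ⟨?_, fun m hm => ?_⟩
  · rw [hprob]
    field_simp
    linarith
  -- superadditivity makes a positive deficit visible in the entropy per site
  have hDtrans : ∀ (t : ℤ × ℤ) T, D (t +ᵥ T) = D T := fun t T => by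
    simp only [hD, vadd_add_cellBall, ← translateSites_product, L.deficit_translate hinv]
  have hDadd : ∀ q : ℕ, (q : ℝ) ^ 2 * D (cellBox m) ≤ D (cellBox (q * m)) := fun q => by
    have := le_sum_tiles (F := fun T => -D T) (by simp [hD, deficit])
      (fun S T hST => by
        have := (L.isClosedWindow hr S).deficit_add_le (L.isClosedWindow hr T)
          (Finset.disjoint_product.2 (Or.inl hST)) μ
        simp only [hD, Finset.union_add, Finset.union_product]
        linarith) 0 q hm
    simp only [hDtrans, Finset.sum_const, card_cellBox, nsmul_eq_mul] at this
    push_cast at this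
    linarith
  rw [show L.evenEntropy μ * k + 0 + P * Real.log 2 - L.topEntropy * (2 * k) = 0 by
    linarith] at hglim
  have hlim : Tendsto (fun q : ℕ => (m : ℝ) ^ 2 * g (q * m)) atTop (𝓝 ((m : ℝ) ^ 2 * 0)) :=
    Tendsto.const_mul _ (hglim.comp (tendsto_id.atTop_mul_const' hm))
  rw [mul_zero] at hlim
  refine ge_of_tendsto hlim ?_
  filter_upwards [eventually_gt_atTop 0] with q hq
  have hq' : (0 : ℝ) < q := by exact_mod_cast hq
  have hm' : (0 : ℝ) < m := by exact_mod_cast hm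
  have h1 := (hDadd q).trans (hup (q * m))
  rw [hg]
  simp only
  rw [mul_div_assoc', le_div_iff₀ (by positivity)]
  push_cast at h1 ⊢
  calc D (cellBox m) * (q * m) ^ 2 = m ^ 2 * (q ^ 2 * D (cellBox m)) := by ring
    _ ≤ _ := by gcongr

/-- A measure of maximal entropy is its own refilled law. -/
theorem IsMaxEntropy.eq_fillIn [Nonempty ι] {μ : Measure (Config ι)} (hμ : L.IsMaxEntropy μ) :
    μ = L.fillIn μ := by
  classical
  have := hμ.prob
  have hinv := hμ.invariant
  obtain ⟨r, hr⟩ := L.exists_range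
  refine measure_ext_of_cyl fun A => ?_
  obtain ⟨M, hM⟩ := (A.image fun v => max v.1.1.natAbs v.1.2.natAbs).exists_le
  set t : ℤ × ℤ := (-M, -M)
  set T := t +ᵥ cellBox (2 * M + 1)
  refine ⟨T ×ˢ L.odds ∪ (T + cellBall r) ×ˢ L.evens, fun v hv => ?_, ?_⟩
  · have h := hM _ (Finset.mem_image_of_mem _ hv)
    have hT : v.1 ∈ T := by
      rw [mem_vadd_cellBox]
      push_cast
      simp only [t]
      omega
    have := subset_add_cellBall r _ hT
    cases he : L.isEven v.2 <;> simp [odds, evens, he, hT, this]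
  · refine (L.isClosedWindow hr T).real_cyl_eq_of_deficit_le μ hμ.hardCore_ae ?_
    have h0 := (hμ.rigidity hr).2 (2 * M + 1) (by omega)
    rw [← L.deficit_translate hinv t, translateSites_product, translateSites_product] at h0
    simpa only [T, vadd_add_cellBall] using h0

end Rigidity

end SplitLattice

/-! ### Averages over translations -/

section Average

open scoped Pointwise

variable {ι : Type*}

theorem shift_shift (s t : ℤ × ℤ) (x : Config ι) : shift s (shift t x) = shift (s + t) x := by
  ext v
  simp only [shift]
  rw [← add_assoc, add_comm t s]

/-- The average of the translates of `ν` by the vectors in `[0,n)²`. -/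
noncomputable def cellAverage (ν : Measure (Config ι)) (n : ℕ) : Measure (Config ι) :=
  ((n : ENNReal) ^ 2)⁻¹ • ∑ t ∈ cellBox n, ν.map (shift t)

theorem cellAverage_real (ν : Measure (Config ι)) [IsProbabilityMeasure ν] (n : ℕ)
    {s : Set (Config ι)} (hs : MeasurableSet s) :
    (cellAverage ν n).real s = (∑ t ∈ cellBox n, ν.real (shift t ⁻¹' s)) / (n : ℝ) ^ 2 := by
  rw [cellAverage, measureReal_def, Measure.smul_apply, smul_eq_mul, ENNReal.toReal_mul,
    Measure.finsetSum_apply, ENNReal.toReal_sum]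
  · rw [div_eq_inv_mul, ENNReal.toReal_inv, ENNReal.toReal_pow, ENNReal.toReal_natCast]
    congr 1
    exact Finset.sum_congr rfl fun t _ => by rw [Measure.map_apply (measurable_shift t) hs]; rfl
  · intro t _
    rw [Measure.map_apply (measurable_shift t) hs]
    exact measure_ne_top _ _

theorem isProbabilityMeasure_cellAverage (ν : Measure (Config ι)) [IsProbabilityMeasure ν] {n : ℕ}
    (hn : 0 < n) : IsProbabilityMeasure (cellAverage ν n) := by
  constructor
  have hn' : ((n : ENNReal) ^ 2) ≠ 0 := by simp [hn.ne']
  rw [cellAverage, Measure.smul_apply, Measure.finsetSum_apply, smul_eq_mul]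
  simp only [Measure.map_apply (measurable_shift _) MeasurableSet.univ, Set.preimage_univ,
    measure_univ, Finset.sum_const, card_cellBox, nsmul_eq_mul, mul_one]
  push_cast
  exact ENNReal.inv_mul_cancel hn' (by simp)

/-- Entropy is concave, so the entropy of the average is at least the average entropy. -/
theorem sum_shannonEntropy_translate_le (ν : Measure (Config ι)) [IsProbabilityMeasure ν] {n : ℕ}
    (hn : 0 < n) (A : Finset (Site ι)) :
    ∑ t ∈ cellBox n, shannonEntropy ν (translateSites t A) ≤
      (n : ℝ) ^ 2 * shannonEntropy (cellAverage ν n) A := by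
  classical
  have := isProbabilityMeasure_cellAverage ν hn
  have hn' : (0 : ℝ) < (n : ℝ) ^ 2 := by positivity
  have hp : ∀ t, IsProbabilityMeasure (ν.map (shift t)) := fun t =>
    Measure.isProbabilityMeasure_map (measurable_shift t).aemeasurable
  rw [Finset.sum_congr rfl fun t _ => (shannonEntropy_map_shift ν t A).symm]
  simp only [shannonEntropy_eq_obsEntropy, obsEntropy_eq_sum _ (measurable_restrict A)]
  rw [Finset.sum_comm, Finset.mul_sum]
  refine Finset.sum_le_sum fun a _ => ?_
  have hs : MeasurableSet (A.restrict ⁻¹' {a} : Set (Config ι)) :=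
    measurable_restrict A (measurableSet_singleton a)
  have hJ := Real.concaveOn_negMulLog.le_map_sum (t := cellBox n)
    (w := fun _ => ((n : ℝ) ^ 2)⁻¹) (p := fun t => (ν.map (shift t)).real (A.restrict ⁻¹' {a}))
    (fun _ _ => by positivity) (by simp [card_cellBox, hn.ne']) (fun _ _ => measureReal_nonneg)
  simp only [smul_eq_mul, ← Finset.mul_sum] at hJ
  rw [cellAverage_real ν n hs, div_eq_inv_mul]
  simp only [map_measureReal_apply (measurable_shift _) hs] at hJ ⊢
  rwa [inv_mul_le_iff₀ hn'] at hJ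

/-- Translating the domain of summation by `s` adds at most a boundary term. -/
theorem sum_cellBox_add_le {f : ℤ × ℤ → ℝ} (h0 : ∀ t, 0 ≤ f t) (h1 : ∀ t, f t ≤ 1) {r : ℕ}
    {s : ℤ × ℤ} (hs : s ∈ cellBall r) (n : ℕ) :
    ∑ t ∈ cellBox n, f (s + t) ≤
      ∑ t ∈ cellBox n, f t + (((n : ℝ) + 2 * r) ^ 2 - (n : ℝ) ^ 2) * 1 := by
  have hsub : s +ᵥ cellBox n ⊆ cellBox n + cellBall r := fun x hx => by
    obtain ⟨y, hy, rfl⟩ := Finset.mem_vadd_finset.1 hx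
    rw [vadd_eq_add, add_comm s y]
    exact Finset.add_mem_add hy hs
  have hmap : ∑ t ∈ cellBox n, f (s + t) = ∑ t ∈ s +ᵥ cellBox n, f t := by
    rw [Finset.vadd_finset_def, Finset.sum_image fun x _ y _ h => by simpa using h]
    rfl
  rw [hmap]
  refine (Finset.sum_le_sum_of_subset_of_nonneg hsub fun t _ _ => h0 t).trans ?_
  rw [← Finset.sum_sdiff (subset_add_cellBall r (cellBox n)), add_comm]
  gcongr
  refine (Finset.sum_le_card_nsmul _ _ 1 fun t _ => h1 t).trans ?_
  rw [Finset.card_sdiff_of_subset (subset_add_cellBall r _), nsmul_eq_mul,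
    Nat.cast_sub (Finset.card_le_card (subset_add_cellBall r _)), card_cellBox]
  push_cast
  gcongr
  exact_mod_cast card_cellBox_add_le r n

/-- The averages over translations of a law keep the entropy per cell, up to a boundary term:
`[0,n)²` is covered by boxes of side `m` in `m²` ways, one for each offset of the grid. -/
theorem mul_shannonEntropy_le_cellAverage [Fintype ι] (ν : Measure (Config ι))
    [IsProbabilityMeasure ν] {n m : ℕ} (hn : 0 < n) (hm : 0 < m) :
    (m : ℝ) ^ 2 * shannonEntropy ν (siteBox ι n) ≤
      (n : ℝ) ^ 2 * shannonEntropy (cellAverage ν n) (siteBox ι m) +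
        (((n : ℝ) + 2 * m) ^ 2 - (n : ℝ) ^ 2) * ((siteBox ι m).card * Real.log 2) := by
  classical
  set f : ℤ × ℤ → ℝ := fun t => shannonEntropy ν (translateSites t (siteBox ι m)) with hf
  set M : ℝ := (siteBox ι m).card * Real.log 2
  have hf0 : ∀ t, 0 ≤ f t := fun t => shannonEntropy_nonneg ν _
  have hfM : ∀ t, f t ≤ M := fun t =>
    (shannonEntropy_le_card ν _).trans_eq (by rw [translateSites, Finset.card_map])
  have hftile : ∀ t, f t = shannonEntropy ν ((t +ᵥ cellBox m) ×ˢ Finset.univ) := fun t => by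
    rw [hf, ← translateSites_product]
    rfl
  set q := n / m + 2
  have hq1 : n + m ≤ q * m := by
    have := Nat.lt_div_mul_add (a := n) hm
    simp only [q, add_mul]
    omega
  have hq2 : q * m ≤ n + 2 * m := by
    have := Nat.div_mul_le_self n m
    simp only [q, add_mul]
    omega
  set v : ℤ × ℤ := (-m, -m) with hv
  have hcover : ∀ s ∈ cellBox m, cellBox n ⊆ (v + s) +ᵥ cellBox (q * m) := fun s hs x hx => by
    rw [mem_vadd_cellBox]
    simp only [cellBox, Finset.mem_product, Finset.mem_Ico] at hs hx
    simp only [hv, Prod.fst_add, Prod.snd_add]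
    omega
  have hone : ∀ s ∈ cellBox m, shannonEntropy ν (siteBox ι n) ≤
      ∑ k ∈ cellBox q, f (v + (m : ℤ) • k + s) := fun s hs => by
    have h1 := le_sum_tiles (F := fun T => shannonEntropy ν (T ×ˢ (Finset.univ : Finset ι)))
      (by simp [shannonEntropy_empty]) (fun S T _ => by
        rw [Finset.union_product]; exact shannonEntropy_union_le ν _ _) (v + s) q hm
    refine (shannonEntropy_mono ν (Finset.product_subset_product (hcover s hs) subset_rfl)).trans
      (h1.trans_eq (Finset.sum_congr rfl fun k _ => ?_))
    rw [hftile, add_right_comm]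
  have hsum : (m : ℝ) ^ 2 * shannonEntropy ν (siteBox ι n) ≤ ∑ t ∈ v +ᵥ cellBox (q * m), f t := by
    have h1 := le_sum_tiles (F := fun T => -∑ t ∈ T, f t) (by simp)
      (fun S T hST => by rw [Finset.sum_union hST, neg_add]) v q hm
    have h2 := Finset.sum_le_sum hone
    rw [Finset.sum_const, card_cellBox, nsmul_eq_mul, Finset.sum_comm] at h2
    have h3 : ∀ w : ℤ × ℤ, ∑ t ∈ w +ᵥ cellBox m, f t = ∑ s ∈ cellBox m, f (w + s) := fun w => by
      rw [Finset.vadd_finset_def, Finset.sum_image fun x _ y _ h => by simpa using h]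
      rfl
    simp only [h3, Finset.sum_neg_distrib] at h1
    push_cast at h2
    linarith
  have hsub : cellBox n ⊆ v +ᵥ cellBox (q * m) := fun x hx => by
    rw [mem_vadd_cellBox]
    simp only [cellBox, Finset.mem_product, Finset.mem_Ico] at hx
    simp only [hv]
    omega
  refine hsum.trans ?_
  rw [← Finset.sum_sdiff hsub, add_comm]
  refine add_le_add (sum_shannonEntropy_translate_le ν hn _) ?_
  refine (Finset.sum_le_card_nsmul _ _ M fun t _ => hfM t).trans ?_
  have hM : 0 ≤ M := (hf0 0).trans (hfM 0)
  rw [Finset.card_sdiff_of_subset hsub, nsmul_eq_mul, Nat.cast_sub (Finset.card_le_card hsub),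
    Finset.card_vadd_finset, card_cellBox, card_cellBox]
  push_cast
  gcongr
  exact_mod_cast hq2

/-- The uniform distribution on representatives of the patterns on `A`. -/
theorem exists_log_patternCount_le_shannonEntropy [Finite ι] {X₀ : Set (Config ι)}
    (hX : X₀.Nonempty) (A : Finset (Site ι)) :
    ∃ ν : Measure (Config ι), IsProbabilityMeasure ν ∧ (∀ᵐ x ∂ν, x ∈ X₀) ∧
      Real.log (patternCount X₀ A) ≤ shannonEntropy ν A := by
  classical
  obtain ⟨Y', hY'X, hY'inj, hY'im⟩ := (Set.surjOn_image (A.restrict : Config ι → A → Bool)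
    X₀).exists_subset_injOn_image_eq
  have hfin : Y'.Finite := Set.Finite.of_finite_image (Set.toFinite _) hY'inj
  obtain ⟨Y, rfl⟩ := hfin.exists_finset_coe
  have hY : Y.Nonempty := by
    have := hX.image (A.restrict : Config ι → A → Bool)
    rw [← hY'im, Set.image_nonempty] at this
    exact_mod_cast this
  have hcard : patternCount X₀ A = Y.card := by
    change (A.restrict '' X₀).ncard = _
    rw [← hY'im, hY'inj.ncard_image, Set.ncard_coe_finset]
  set ν := (PMF.uniformOfFinset Y hY).toMeasure with hν
  have hae : ∀ᵐ x ∂ν, x ∈ Y := by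
    change ν (↑Y)ᶜ = 0
    rw [hν, PMF.toMeasure_uniformOfFinset_apply _ _ Y.measurableSet.compl]
    simp
  refine ⟨ν, inferInstance, hae.mono fun x hx => hY'X hx, ?_⟩
  rw [shannonEntropy_eq_integral, hcard]
  have hc : ∀ᵐ x ∂ν, -Real.log (ν.real (cyl A x)) = Real.log Y.card := by
    filter_upwards [hae] with x hx
    have : (Y.filter fun y => y ∈ cyl A x) = {x} := by
      ext y
      simp only [Finset.mem_filter, Finset.mem_singleton]
      refine ⟨fun h => hY'inj h.1 hx (restrict_eq_restrict_iff.2 h.2), ?_⟩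
      rintro rfl
      exact ⟨hx, fun _ _ => rfl⟩
    rw [measureReal_def, hν, PMF.toMeasure_uniformOfFinset_apply _ _ (measurableSet_cyl A x), this]
    simp
  rw [integral_congr_ae hc]
  simp

/-! ### Weak limits -/

theorem isClopen_restrict_preimage (A : Finset (Site ι)) (s : Set (A → Bool)) :
    IsClopen (A.restrict ⁻¹' s : Set (Config ι)) :=
  (isClopen_discrete s).preimage (Finset.continuous_restrict A)

variable [Finite ι]

theorem tendsto_real_of_isClopen {F : Filter ℕ} {μs : ℕ → ProbabilityMeasure (Config ι)}
    {μ : ProbabilityMeasure (Config ι)} (h : Tendsto μs F (𝓝 μ)) {s : Set (Config ι)}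
    (hs : IsClopen s) :
    Tendsto (fun n => (μs n : Measure (Config ι)).real s) F
      (𝓝 ((μ : Measure (Config ι)).real s)) :=
  (NNReal.continuous_coe.tendsto _).comp
    (ProbabilityMeasure.tendsto_measure_of_isClopen_of_tendsto h hs)

theorem tendsto_shannonEntropy {F : Filter ℕ} {μs : ℕ → ProbabilityMeasure (Config ι)}
    {μ : ProbabilityMeasure (Config ι)} (h : Tendsto μs F (𝓝 μ)) (A : Finset (Site ι)) :
    Tendsto (fun n => shannonEntropy (μs n : Measure (Config ι)) A) F
      (𝓝 (shannonEntropy (μ : Measure (Config ι)) A)) := by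
  classical
  simp only [shannonEntropy_eq_obsEntropy, obsEntropy_eq_sum _ (measurable_restrict A)]
  exact tendsto_finsetSum _ fun a _ => (Real.continuous_negMulLog.tendsto _).comp
    (tendsto_real_of_isClopen h (isClopen_restrict_preimage A {a}))

end Average

/-! ### Existence of a measure of maximal entropy -/

namespace SplitLattice

variable {ι : Type*} [Fintype ι] (L : SplitLattice ι)

/-- A weak limit of the averaged uniform distributions on the patterns on large boxes is a measure
of maximal entropy. -/
theorem exists_isMaxEntropy [Nonempty ι] : ∃ μ : Measure (Config ι), L.IsMaxEntropy μ := by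
  classical
  choose ν hνprob hνX hνent using fun n : ℕ =>
    exists_log_patternCount_le_shannonEntropy L.hardCore_nonempty (siteBox ι (n + 1))
  have hprob : ∀ n, IsProbabilityMeasure (cellAverage (ν n) (n + 1)) := fun n =>
    isProbabilityMeasure_cellAverage _ n.succ_pos
  set μs : ℕ → ProbabilityMeasure (Config ι) := fun n => ⟨cellAverage (ν n) (n + 1), hprob n⟩
  have hμs : ∀ n, (μs n : Measure (Config ι)) = cellAverage (ν n) (n + 1) := fun n => rfl
  set F : Ultrafilter ℕ := hyperfilter ℕ
  have hF : (F : Filter ℕ) ≤ atTop := Nat.hyperfilter_le_atTop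
  obtain ⟨μ, hμ⟩ : ∃ μ, Tendsto μs F (𝓝 μ) := ⟨_, (F.map μs).le_nhds_lim⟩
  have hF1 : Tendsto (fun n => n + 1) (F : Filter ℕ) atTop := (tendsto_add_atTop_nat 1).mono_left hF
  -- two occupied neighbours form a clopen event
  have hpair : ∀ u v, L.graph.Adj u v →
      ∀ᵐ x ∂(μ : Measure (Config ι)), ¬ (x u = true ∧ x v = true) := fun u v huv => by
    have hcl : IsClopen {x : Config ι | x u = true ∧ x v = true} :=
      ((isClopen_discrete {true}).preimage (continuous_apply u)).inter
        ((isClopen_discrete {true}).preimage (continuous_apply v))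
    have h0 : ∀ n, (μs n : Measure (Config ι)).real {x | x u = true ∧ x v = true} = 0 := fun n => by
      have := hνprob n
      rw [hμs, cellAverage_real _ _ hcl.2.measurableSet, Finset.sum_eq_zero, zero_div]
      intro t _
      rw [measureReal_eq_zero_iff]
      exact measure_mono_null (fun x hx (hx' : x ∈ L.hardCore) =>
        L.shift_mem_hardCore t x hx' u v huv hx) (hνX n)
    have := tendsto_nhds_unique (tendsto_real_of_isClopen hμ hcl)
      (tendsto_const_nhds.congr fun n => (h0 n).symm)
    rw [measureReal_eq_zero_iff] at this
    exact measure_eq_zero_iff_ae_notMem.1 this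
  have hall : ∀ᵐ x ∂(μ : Measure (Config ι)), ∀ u v, L.graph.Adj u v →
      ¬ (x u = true ∧ x v = true) :=
    ae_all_iff.2 fun u => ae_all_iff.2 fun v => by
      by_cases huv : L.graph.Adj u v
      · filter_upwards [hpair u v huv] with x hx _ using hx
      · exact Eventually.of_forall fun x h => absurd h huv
  refine ⟨μ, inferInstance, fun s => ?_, ?_, ?_⟩
  · -- the averages are invariant up to a boundary term
    have hle : ∀ (s : ℤ × ℤ) (A : Finset (Site ι)) (a : Set (A → Bool)),
        (μ : Measure (Config ι)).real (shift s ⁻¹' (A.restrict ⁻¹' a)) ≤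
          (μ : Measure (Config ι)).real (A.restrict ⁻¹' a) := fun s A a => by
      obtain ⟨r, hr⟩ : ∃ r, s ∈ cellBall r := ⟨max s.1.natAbs s.2.natAbs, by
        simp only [cellBall, Finset.mem_product, Finset.mem_Icc]; omega⟩
      have hcont : Continuous (shift s : Config ι → Config ι) :=
        continuous_pi fun _ => continuous_apply _
      have hcl := isClopen_restrict_preimage A a
      have hB := (tendsto_boundary_div_sq r 1).comp hF1
      have hlim := (tendsto_real_of_isClopen hμ hcl).add hB
      rw [add_zero] at hlim
      refine le_of_tendsto_of_tendsto' (tendsto_real_of_isClopen hμ (hcl.preimage hcont)) hlim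
        fun n => ?_
      have := hνprob n
      simp only [Function.comp_apply]
      rw [hμs, cellAverage_real _ _ hcl.2.measurableSet,
        cellAverage_real _ _ (hcl.preimage hcont).2.measurableSet, ← add_div]
      refine div_le_div_of_nonneg_right ?_ (by positivity)
      refine le_trans (le_of_eq ?_) (sum_cellBox_add_le
        (f := fun t => (ν n).real (shift t ⁻¹' (A.restrict ⁻¹' a)))
        (fun _ => measureReal_nonneg) (fun _ => measureReal_le_one) hr (n + 1))
      refine Finset.sum_congr rfl fun t _ => ?_
      congr 1
      ext x
      simp only [Set.mem_preimage, shift_shift]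
    have := Measure.isProbabilityMeasure_map (μ := (μ : Measure (Config ι)))
      (measurable_shift s).aemeasurable
    refine measure_ext_of_cyl fun A => ⟨A, subset_rfl, fun x => ?_⟩
    rw [map_measureReal_apply (measurable_shift s) (measurableSet_cyl A x)]
    refine le_antisymm ?_ ?_
    · simpa only [restrict_preimage_singleton] using hle s A {A.restrict x}
    · have hx : cyl (translateSites s A) (shift (-s) x) = shift s ⁻¹' cyl A x := by
        rw [← shift_preimage_cyl]
        congr 2
        ext v
        simp [shift]
      have := hle (-s) (translateSites s A) {(translateSites s A).restrict (shift (-s) x)}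
      rw [restrict_preimage_singleton, hx] at this
      refine le_trans (le_of_eq ?_) this
      congr 1
      ext y
      simp [shift, cyl]
  · exact hall
  · have hbox : ∀ m, ((siteBox ι m).card : ℝ) = (m : ℝ) ^ 2 * Fintype.card ι := fun m => by
      rw [show siteBox ι m = cellBox m ×ˢ Finset.univ from rfl, Finset.card_product, card_cellBox,
        Finset.card_univ]
      push_cast
      rfl
    have hlow : ∀ m, 0 < m → L.topEntropy * (siteBox ι m).card ≤
        shannonEntropy (μ : Measure (Config ι)) (siteBox ι m) := fun m hm => by
      have hlim := (tendsto_shannonEntropy hμ (siteBox ι m)).add ((tendsto_boundary_div_sq m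
        ((siteBox ι m).card * Real.log 2)).comp hF1)
      rw [add_zero] at hlim
      refine ge_of_tendsto' hlim fun n => ?_
      have := hνprob n
      have h1 := mul_shannonEntropy_le_cellAverage (ν n) n.succ_pos hm
      have h2 := mul_le_mul_of_nonneg_left
        ((L.tendsto_topRate.2 (n + 1) n.succ_pos).trans (hνent n)) (sq_nonneg (m : ℝ))
      have hn : (0 : ℝ) < ((n + 1 : ℕ) : ℝ) ^ 2 := by positivity
      rw [hbox (n + 1)] at h2
      simp only [Function.comp_apply, hμs]
      rw [← mul_le_mul_iff_right₀ hn, mul_add, mul_div_cancel₀ _ hn.ne']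
      refine le_trans (le_of_eq ?_) (h2.trans h1)
      rw [hbox m]
      ring
    refine tendsto_of_tendsto_of_tendsto_of_le_of_le' tendsto_const_nhds L.tendsto_topRate.1 ?_ ?_
    · filter_upwards [eventually_gt_atTop 0] with m hm
      have : (0 : ℝ) < (siteBox ι m).card := by
        rw [hbox]
        have : 0 < Fintype.card ι := Fintype.card_pos
        positivity
      rw [le_div_iff₀ this]
      exact hlow m hm
    · refine Eventually.of_forall fun m => div_le_div_of_nonneg_right ?_ (by positivity)
      exact shannonEntropy_le_log_patternCount _ hall _

end SplitLattice

theorem proposition2p1 {ι : Type*} [Fintype ι] [Nonempty ι] (L : SplitLattice ι) :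
    Tendsto L.topRate atTop (𝓝 L.topEntropy) ∧
    (∃ μ : Measure (Config ι), L.IsMaxEntropy μ) ∧
    ∀ μ : Measure (Config ι), L.IsMaxEntropy μ →
      Tendsto (L.evenRate μ) atTop (𝓝 (L.evenEntropy μ)) ∧
      L.topEntropy = 1 / 2 * (L.evenEntropy μ + L.probUnblocked μ * Real.log 2) ∧
      μ = L.fillIn μ := by
  refine ⟨L.tendsto_topRate.1, L.exists_isMaxEntropy, fun μ hμ => ?_⟩
  have := hμ.prob
  obtain ⟨r, hr⟩ := L.exists_range
  exact ⟨L.tendsto_evenRate μ hμ.invariant, (hμ.rigidity hr).1, hμ.eq_fillIn⟩
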